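/- \textbf{Definitions.} Let $\mathbb D$ be the open unit disc, $\overline{\mathbb D}$ its closure and $\mathbb T$ the unit circle. The \emph{tetrablock} is $$\mathbb E=\{(x_1,x_2,x_3)\in\mathbb C^3:\ 1-x_1z-x_2w+x_3zw\neq 0\ \text{ whenever } |z|\le 1,\ |w|\le 1\},$$ $\overline{\mathbb E}$ is its closure, and $b\overline{\mathbb E}$ is its distinguished (Shilov) boundary: the smallest closed subset of $\overline{\mathbb E}$ on which every function that is continuous on $\overline{\mathbb E}$ and holomorphic on $\mathbb E$ attains its maximum modulus. An \emph{$\overline{\mathbb E}$-inner} (\emph{tetra-inner}) function is an analytic map $x=(x_1,x_2,x_3):\mathbb D\to\overline{\mathbb E}$ such that $\lim_{r\to1^-}x(r\lambda)$ exists and belongs to $b\overline{\mathbb E}$ for almost all $\lambda\in\mathbb T$ with respect to Lebesgue measure. It is \emph{rational} if $x_1,x_2,x_3$ are rational functions; it then extends continuously to $\overline{\mathbb D}$, the extension (again denoted by $x$) maps $\mathbb T$ into $b\overline{\mathbb E}$, and the \emph{degree} of $x$ is the integer $x_*(1)$, where $x_*:\mathbb Z=\pi_1(\mathbb T)\to\pi_1(b\overline{\mathbb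 E})\cong\mathbb Z$ is the homomorphism induced by $x|_{\mathbb T}$ and the identification $\pi_1(b\overline{\mathbb E})\cong\mathbb Z$ is chosen so that the degree is non-negative. For a polynomial $f$ of degree at most $n$ let $f^{\sim n}$ be the polynomial $f^{\sim n}(\lambda)=\lambda^n\,\overline{f(1/\overline\lambda)}$. \textbf{Theorem.} Let $n\ge 0$ be an integer. (a) Let $x=(x_1,x_2,x_3)$ be a rational $\overline{\mathbb E}$-inner function of degree $n$. Then there exist polynomials $E_1,E_2,D$ such that \begin{enumerate} \item $\deg(E_1),\deg(E_2),\deg(D)\le n$, \item $D(\lambda)\ne0$ on $\overline{\mathbb D}$, \item $x_3=D^{\sim n}/D$ on $\overline{\mathbb D}$, \item $x_1=E_1/D$ on $\overline{\mathbb D}$, \item $x_2=E_2/D$ on $\overline{\mathbb D}$, \item $|E_i(\lambda)|\le|D(\lambda)|$ on $\overline{\mathbb D}$ for $i=1,2$, \item $E_1(\lambda)=E_2^{\sim n}(\lambda)$ for $\lambda\in\overline{\mathbb D}$. \end{enumerate} (b) Furthermore, if $E_1,E_2,D$ satisfy (1)--(7) for the function $x$ of (a), then a triple of polynomials $E_1^1,E_2^1,D^1$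 satisfies (1)--(7) for $x$ if and only if there is a real number $t\ne0$ such that $E_1^1=tE_1$, $E_2^1=tE_2$ and $D^1=tD$. (c) Conversely, if polynomials $E_1,E_2,D$ satisfy (1), (6) and (7), $D(\lambda)\ne0$ on $\mathbb D$, and $x_1=E_1/D$, $x_2=E_2/D$, $x_3=D^{\sim n}/D$ on $\mathbb D$, then $x=(x_1,x_2,x_3)$ is a rational $\overline{\mathbb E}$-inner function of degree at most $n$. -/

import Mathlib

open Complex Set Filter Topology MeasureTheory Polynomial

/-- The open unit disc `𝔻` of `ℂ`. -/
abbrev unitDisc : Set ℂ := Metric.ball 0 1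

/-- The closed unit disc of `ℂ`. -/
abbrev closedUnitDisc : Set ℂ := Metric.closedBall 0 1

/-- The (open) tetrablock `𝔼 ⊆ ℂ³`: the points `(x₁, x₂, x₃)` such that
`1 - x₁ z - x₂ w + x₃ z w ≠ 0` whenever `|z| ≤ 1` and `|w| ≤ 1`. -/
def tetrablock : Set (ℂ × ℂ × ℂ) :=
  {x | ∀ z w : ℂ, ‖z‖ ≤ 1 → ‖w‖ ≤ 1 → 1 - x.1 * z - x.2.1 * w + x.2.2 * (z * w) ≠ 0}

/-- `C` is a closed boundary of `Ω`: a closed subset of the closure of `Ω` on which every function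
that is continuous on the closure of `Ω` and holomorphic on `Ω` attains its maximum modulus. -/
def IsClosedBoundary {V : Type*} [NormedAddCommGroup V] [NormedSpace ℂ V] (Ω C : Set V) : Prop :=
  IsClosed C ∧ C ⊆ closure Ω ∧
    ∀ f : V → ℂ, DiffContOnCl ℂ f Ω → ∃ c ∈ C, ∀ z ∈ closure Ω, ‖f z‖ ≤ ‖f c‖

/-- The distinguished (Shilov) boundary of the closure of `Ω`: the smallest closed boundary,
that is, the intersection of all closed boundaries. -/
def distinguishedBoundary {V : Type*} [NormedAddCommGroup V] [NormedSpace ℂ V] (Ω : Set V) :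
    Set V :=
  ⋂₀ {C | IsClosedBoundary Ω C}

/-- The distinguished boundary of the closed tetrablock. -/
abbrev tetraBoundary : Set (ℂ × ℂ × ℂ) := distinguishedBoundary tetrablock

/-- `x` (only its values on the open unit disc matter) is tetra-inner: an analytic map of the disc
into the closed tetrablock whose radial limits exist and lie in the distinguished boundary
at almost all points of the unit circle with respect to Lebesgue measure. -/
def IsTetraInner (x : ℂ → ℂ × ℂ × ℂ) : Prop :=
  DifferentiableOn ℂ x unitDisc ∧
  MapsTo x unitDisc (closure tetrablock) ∧
  ∀ᵐ θ : ℝ ∂(volume.restrict (Ioc 0 (2 * Real.pi))),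
    ∃ l ∈ tetraBoundary,
      Tendsto (fun r : ℝ => x (r * Complex.exp (θ * I))) (𝓝[<] 1) (𝓝 l)

/-- `f` is, on the open unit disc, a rational function (without poles there). -/
def IsRationalOnDisc (f : ℂ → ℂ) : Prop :=
  ∃ p q : ℂ[X], ∀ z ∈ unitDisc, q.eval z ≠ 0 ∧ f z = p.eval z / q.eval z

/-- Rational tetra-inner functions. -/
def IsRationalTetraInner (x : ℂ → ℂ × ℂ × ℂ) : Prop :=
  IsTetraInner x ∧
  IsRationalOnDisc (fun z => (x z).1) ∧
  IsRationalOnDisc (fun z => (x z).2.1) ∧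
  IsRationalOnDisc (fun z => (x z).2.2)

/-- The loop `t ↦ exp (2 π i t)` in the unit circle. -/
noncomputable def circleLoop : Path (1 : Circle) 1 where
  toFun t := Circle.exp (2 * Real.pi * (t : ℝ))
  continuous_toFun := by fun_prop
  source' := by simp
  target' := by simp

/-- The standard generator `1 ∈ ℤ = π₁(𝕋)`: the class of the identity map of the circle. -/
noncomputable def circleGenerator : FundamentalGroup Circle 1 :=
  FundamentalGroup.fromPath (Path.Homotopic.Quotient.mk circleLoop)

/-- The tetra-inner function `x` has degree `n`. Let `g : 𝕋 → bĒ` be the continuous map of radial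
limits of `x`, and `g_* : π₁(𝕋) → π₁(bĒ)` the homomorphism that it induces. Then `n = g_*(1)`
when `π₁(bĒ)` is identified with `ℤ`; of the two identifications, which differ by a sign, one is
taken that makes the degree non-negative. -/
def HasTetraDegree (x : ℂ → ℂ × ℂ × ℂ) (n : ℕ) : Prop :=
  ∃ g : C(Circle, tetraBoundary),
    (∀ ζ : Circle, Tendsto (fun r : ℝ => x (r * (ζ : ℂ))) (𝓝[<] 1) (𝓝 (g ζ : ℂ × ℂ × ℂ))) ∧
    ∃ φ : FundamentalGroup tetraBoundary (g 1) ≃* Multiplicative ℤ,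
      φ (FundamentalGroup.map g 1 circleGenerator) = Multiplicative.ofAdd (n : ℤ)

/-- The polynomial `f^{∼n}(z) = z ^ n * conj (f (1 / conj z))`, for `f` of degree at most `n`. -/
noncomputable def conjReflect (n : ℕ) (f : ℂ[X]) : ℂ[X] :=
  (f.map (starRingEnd ℂ)).reflect n

theorem eval_conjReflect (n : ℕ) (f : ℂ[X]) (hf : f.natDegree ≤ n) (z : ℂ) (hz : z ≠ 0) :
    (conjReflect n f).eval z
      = z ^ n * (starRingEnd ℂ) (f.eval (1 / (starRingEnd ℂ) z)) := by
  have h1 : (starRingEnd ℂ) (f.eval (1 / (starRingEnd ℂ) z))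
      = (f.map (starRingEnd ℂ)).eval z⁻¹ := by
    rw [← Polynomial.eval_map_apply]
    simp
  let _ : Invertible z⁻¹ := invertibleOfNonzero (inv_ne_zero hz)
  have h2 := Polynomial.eval₂_reflect_mul_pow (RingHom.id ℂ) z⁻¹ n (f.map (starRingEnd ℂ))
    ((Polynomial.natDegree_map_le).trans hf)
  simp only [invOf_eq_inv, inv_inv, Polynomial.eval₂_id] at h2
  rw [h1, ← h2, conjReflect, mul_comm _ ((z⁻¹) ^ n), ← mul_assoc, ← mul_pow, mul_inv_cancel₀ hz,
    one_pow, one_mul]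

/-- The function `f` on the open unit disc, extended by continuity to the closed unit disc, equals
`g` at every point of the closed disc. At points of the open disc this says `f z = g z`. -/
def ExtensionEqOnClosedDisc (f g : ℂ → ℂ) : Prop :=
  ∀ z ∈ closedUnitDisc, Tendsto f (𝓝[unitDisc] z) (𝓝 (g z))

/-- The polynomials `E₁, E₂, D` represent `x` as `(E₁ / D, E₂ / D, D^{∼n} / D)`, with all the
conditions on degrees, zeros, size and symmetry. -/
structure IsTetraRepresentation (n : ℕ) (x : ℂ → ℂ × ℂ × ℂ) (E₁ E₂ D : ℂ[X]) : Prop where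
  natDegree_E₁_le : E₁.natDegree ≤ n
  natDegree_E₂_le : E₂.natDegree ≤ n
  natDegree_D_le : D.natDegree ≤ n
  D_ne_zero : ∀ z ∈ closedUnitDisc, D.eval z ≠ 0
  x₃_eq : ExtensionEqOnClosedDisc (fun z => (x z).2.2)
    (fun z => (conjReflect n D).eval z / D.eval z)
  x₁_eq : ExtensionEqOnClosedDisc (fun z => (x z).1) (fun z => E₁.eval z / D.eval z)
  x₂_eq : ExtensionEqOnClosedDisc (fun z => (x z).2.1) (fun z => E₂.eval z / D.eval z)
  norm_E₁_le : ∀ z ∈ closedUnitDisc, ‖E₁.eval z‖ ≤ ‖D.eval z‖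
  norm_E₂_le : ∀ z ∈ closedUnitDisc, ‖E₂.eval z‖ ≤ ‖D.eval z‖
  E₁_eq : ∀ z ∈ closedUnitDisc, E₁.eval z = (conjReflect n E₂).eval z

/-!
The distinguished boundary of the closed tetrablock is the set of its points with `|x₃| = 1`, on
which `x₁ = x̄₂ x₃`: every point of the tetrablock lies on an analytic disc whose boundary is in
this set, so the maximum principle makes it a closed boundary, and each of its points is a peak
point of a polynomial. On the unit circle a rational tetra-inner function `x` takes values in this
set. Hence `x₃` is a finite Blaschke product `D^∼ⁿ / D`, and comparing denominators in
`x₁ = x̄₂ x₃` turns `x₂ = E / D` into `x₁ = E^∼ⁿ / D`.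

The third coordinate is a homotopy equivalence of the distinguished boundary with the circle, so
the degree of `x` is the winding number of `x₃ = zⁿ D̄ / D`. It equals `n`, because `D` has no
zero on the closed disc and hence has a logarithm there. In the converse, `D` may vanish on the
circle; there `E` vanishes too, and cancelling such a common zero lowers `n` by one.
-/

open scoped ComplexConjugate ContinuousMap

/-! ### The unit circle and the maximum modulus principle -/

theorem mul_conj_eq_one_of_norm_eq_one {z : ℂ} (hz : ‖z‖ = 1) : z * conj z = 1 := by
  rw [mul_conj', hz, ofReal_one, one_pow]

theorem exists_norm_eq_one_mul_eq_conj {c : ℂ} (hc : ‖c‖ = 1) :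
    ∃ u : ℂ, ‖u‖ = 1 ∧ c * u = conj u := by
  obtain ⟨u, hu⟩ := IsAlgClosed.exists_pow_nat_eq (conj c) two_pos
  have hnorm : ‖u‖ = 1 := by
    have h := congrArg norm hu
    rwa [norm_pow, RCLike.norm_conj, hc, pow_eq_one_iff_of_nonneg (norm_nonneg u) two_ne_zero] at h
  refine ⟨u, hnorm, ?_⟩
  linear_combination (-c * u) * mul_conj_eq_one_of_norm_eq_one hnorm + c * conj u * hu
    + conj u * mul_conj_eq_one_of_norm_eq_one hc

theorem infinite_unit_sphere : (Metric.sphere (0 : ℂ) 1).Infinite := by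
  have hrank : 1 < Module.rank ℝ ℂ := by
    rw [rank_real_complex]
    norm_num
  exact (isPreconnected_sphere hrank 0 1).infinite_of_nontrivial
    ⟨1, by simp, -1, by simp, by norm_num⟩

theorem closure_unitDisc : closure unitDisc = closedUnitDisc := closure_ball 0 one_ne_zero

theorem norm_le_of_norm_le_on_circle {F : Type*} [NormedAddCommGroup F] [NormedSpace ℂ F]
    {f : ℂ → F} (hf : DiffContOnCl ℂ f unitDisc) {M : ℝ} (hM : ∀ z, ‖z‖ = 1 → ‖f z‖ ≤ M)
    {z : ℂ} (hz : ‖z‖ ≤ 1) : ‖f z‖ ≤ M := by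
  refine norm_le_of_forall_mem_frontier_norm_le Metric.isBounded_ball hf (fun w hw => hM w ?_)
    (closure_unitDisc.superset (mem_closedBall_zero_iff.2 hz))
  rwa [frontier_ball _ one_ne_zero, mem_sphere_zero_iff_norm] at hw

theorem norm_eq_on_circle_of_le_norm {F : Type*} [NormedAddCommGroup F] [NormedSpace ℂ F]
    {f : ℂ → F} (hf : DiffContOnCl ℂ f unitDisc) {M : ℝ} (hM : ∀ z, ‖z‖ = 1 → ‖f z‖ ≤ M)
    {a : ℂ} (ha : ‖a‖ < 1) (hMa : M ≤ ‖f a‖) {z : ℂ} (hz : ‖z‖ = 1) : ‖f z‖ = M := by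
  have hmax : IsMaxOn (norm ∘ f) unitDisc a := fun w hw =>
    (norm_le_of_norm_le_on_circle hf hM (mem_ball_zero_iff.1 hw).le).trans hMa
  have heq := norm_eqOn_closure_of_isPreconnected_of_isMaxOn
    (convex_ball (0 : ℂ) 1).isPreconnected Metric.isOpen_ball hf (mem_ball_zero_iff.2 ha) hmax
    (closure_unitDisc.superset (mem_closedBall_zero_iff.2 hz.le))
  exact (hM z hz).antisymm (hMa.trans_eq heq.symm)

/-! ### Geometry of the tetrablock -/

theorem swap_mem_tetrablock {x : ℂ × ℂ × ℂ} (hx : x ∈ tetrablock) :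
    ((x.2.1, x.1, x.2.2) : ℂ × ℂ × ℂ) ∈ tetrablock := fun z w hz hw h =>
  hx w z hw hz (by linear_combination h)

theorem norm_fst_lt_one_of_mem_tetrablock {x : ℂ × ℂ × ℂ} (hx : x ∈ tetrablock) : ‖x.1‖ < 1 := by
  by_contra! h
  have hx₁ : x.1 ≠ 0 := norm_pos_iff.1 (one_pos.trans_le h)
  refine hx x.1⁻¹ 0 ?_ (norm_zero.trans_le zero_le_one) (by simp [hx₁])
  rw [norm_inv]
  exact inv_le_one_of_one_le₀ h

theorem norm_sub_mul_lt_of_mem_tetrablock {x : ℂ × ℂ × ℂ} (hx : x ∈ tetrablock) {z : ℂ}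
    (hz : ‖z‖ ≤ 1) : ‖x.2.1 - x.2.2 * z‖ < ‖1 - x.1 * z‖ := by
  by_contra! h
  have hden : 1 - x.1 * z ≠ 0 := by simpa using hx z 0 hz (by simp)
  have hnum : x.2.1 - x.2.2 * z ≠ 0 := norm_pos_iff.1 ((norm_pos_iff.2 hden).trans_le h)
  refine hx z ((1 - x.1 * z) / (x.2.1 - x.2.2 * z)) hz ?_ ?_
  · rw [norm_div]
    exact div_le_one_of_le₀ h (norm_nonneg _)
  · linear_combination -div_mul_cancel₀ (1 - x.1 * z) hnum

theorem two_mul_norm_lt_of_mem_tetrablock {x : ℂ × ℂ × ℂ} (hx : x ∈ tetrablock) :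
    2 * ‖x.1 - conj x.2.1 * x.2.2‖ < 1 + ‖x.1‖ ^ 2 - ‖x.2.1‖ ^ 2 - ‖x.2.2‖ ^ 2 := by
  obtain ⟨z, hz, hzu⟩ := exists_norm_eq_mul_self (x.1 - conj x.2.1 * x.2.2)
  have hsq : ‖x.2.1 - x.2.2 * z‖ ^ 2 < ‖1 - x.1 * z‖ ^ 2 := by
    gcongr
    exact norm_sub_mul_lt_of_mem_tetrablock hx hz.le
  have hzu' := congrArg conj hzu
  simp only [map_mul, map_sub, conj_conj, conj_ofReal] at hzu'
  have hexpand : ‖1 - x.1 * z‖ ^ 2 - ‖x.2.1 - x.2.2 * z‖ ^ 2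
      = 1 + ‖x.1‖ ^ 2 - ‖x.2.1‖ ^ 2 - ‖x.2.2‖ ^ 2 - 2 * ‖x.1 - conj x.2.1 * x.2.2‖ := by
    apply ofReal_injective
    push_cast
    simp only [← mul_conj', map_sub, map_one, map_mul]
    linear_combination (x.1 * conj x.1 - x.2.2 * conj x.2.2) * mul_conj_eq_one_of_norm_eq_one hz
      + hzu + hzu'
  linarith

theorem norm_add_norm_lt_of_mem_tetrablock {x : ℂ × ℂ × ℂ} (hx : x ∈ tetrablock) :
    ‖x.1 - conj x.2.1 * x.2.2‖ + ‖x.2.1 - conj x.1 * x.2.2‖ < 1 - ‖x.2.2‖ ^ 2 := by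
  linarith [two_mul_norm_lt_of_mem_tetrablock hx,
    two_mul_norm_lt_of_mem_tetrablock (swap_mem_tetrablock hx)]

theorem norm_add_norm_le_of_mem_closure_tetrablock {x : ℂ × ℂ × ℂ} (hx : x ∈ closure tetrablock) :
    ‖x.1 - conj x.2.1 * x.2.2‖ + ‖x.2.1 - conj x.1 * x.2.2‖ ≤ 1 - ‖x.2.2‖ ^ 2 := by
  refine closure_minimal (t := {x : ℂ × ℂ × ℂ | ‖x.1 - conj x.2.1 * x.2.2‖
    + ‖x.2.1 - conj x.1 * x.2.2‖ ≤ 1 - ‖x.2.2‖ ^ 2})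
    (fun y hy => (norm_add_norm_lt_of_mem_tetrablock hy).le) ?_ hx
  apply isClosed_le <;> fun_prop

theorem norm_trd_lt_one_of_mem_tetrablock {x : ℂ × ℂ × ℂ} (hx : x ∈ tetrablock) :
    ‖x.2.2‖ < 1 := by
  rw [← sq_lt_one_iff₀ (norm_nonneg _)]
  linarith [norm_add_norm_lt_of_mem_tetrablock hx, norm_nonneg (x.1 - conj x.2.1 * x.2.2),
    norm_nonneg (x.2.1 - conj x.1 * x.2.2)]

theorem norm_le_one_of_mem_closure_tetrablock {x : ℂ × ℂ × ℂ} (hx : x ∈ closure tetrablock) :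
    ‖x‖ ≤ 1 := by
  refine closure_minimal (t := {x : ℂ × ℂ × ℂ | ‖x‖ ≤ 1}) (fun y hy => ?_)
    (isClosed_le (by fun_prop) (by fun_prop)) hx
  exact max_le (norm_fst_lt_one_of_mem_tetrablock hy).le
    (max_le (norm_fst_lt_one_of_mem_tetrablock (swap_mem_tetrablock hy)).le
      (norm_trd_lt_one_of_mem_tetrablock hy).le)

theorem norm_fst_le_one_of_mem_closure_tetrablock {x : ℂ × ℂ × ℂ} (hx : x ∈ closure tetrablock) :
    ‖x.1‖ ≤ 1 := (norm_fst_le x).trans (norm_le_one_of_mem_closure_tetrablock hx)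

theorem norm_snd_le_one_of_mem_closure_tetrablock {x : ℂ × ℂ × ℂ} (hx : x ∈ closure tetrablock) :
    ‖x.2.1‖ ≤ 1 :=
  ((norm_fst_le x.2).trans (norm_snd_le x)).trans (norm_le_one_of_mem_closure_tetrablock hx)

theorem norm_trd_le_one_of_mem_closure_tetrablock {x : ℂ × ℂ × ℂ} (hx : x ∈ closure tetrablock) :
    ‖x.2.2‖ ≤ 1 :=
  ((norm_snd_le x.2).trans (norm_snd_le x)).trans (norm_le_one_of_mem_closure_tetrablock hx)

theorem mem_closure_tetrablock_of_forall_ne_zero {x : ℂ × ℂ × ℂ}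
    (hx : ∀ z w : ℂ, ‖z‖ < 1 → ‖w‖ < 1 → 1 - x.1 * z - x.2.1 * w + x.2.2 * (z * w) ≠ 0) :
    x ∈ closure tetrablock := by
  let s : ℝ → ℂ × ℂ × ℂ := fun r => (r * x.1, r * x.2.1, r ^ 2 * x.2.2)
  have hs : Tendsto s (𝓝[<] 1) (𝓝 x) := by
    have h : Tendsto s (𝓝 1) (𝓝 (s 1)) := Continuous.tendsto (by fun_prop) 1
    simp only [s, ofReal_one, one_mul, one_pow] at h
    exact h.mono_left nhdsWithin_le_nhds
  refine mem_closure_of_tendsto hs ?_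
  filter_upwards [Ioo_mem_nhdsLT (zero_lt_one' ℝ)] with r hr z w hz hw h
  have hscale (z : ℂ) (hz : ‖z‖ ≤ 1) : ‖r * z‖ < 1 := by
    rw [norm_mul, norm_real, Real.norm_of_nonneg hr.1.le]
    exact (mul_le_of_le_one_right hr.1.le hz).trans_lt hr.2
  exact hx (r * z) (r * w) (hscale z hz) (hscale w hw) (by linear_combination h)

theorem mem_closure_tetrablock_of_norm_sub_mul_le {x : ℂ × ℂ × ℂ} (hx₁ : ‖x.1‖ ≤ 1)
    (h : ∀ z : ℂ, ‖z‖ < 1 → ‖x.2.1 - x.2.2 * z‖ ≤ ‖1 - x.1 * z‖) : x ∈ closure tetrablock := by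
  refine mem_closure_tetrablock_of_forall_ne_zero fun z w hz hw h0 => ?_
  have hx₁z : ‖x.1 * z‖ < 1 := by
    rw [norm_mul]
    exact (mul_le_of_le_one_left (norm_nonneg z) hx₁).trans_lt hz
  have hden : 1 - x.1 * z ≠ 0 := sub_ne_zero.2 fun h1 => by simp [← h1] at hx₁z
  have heq : 1 - x.1 * z = w * (x.2.1 - x.2.2 * z) := by linear_combination h0
  have hlt : ‖w‖ * ‖x.2.1 - x.2.2 * z‖ < ‖1 - x.1 * z‖ :=
    (mul_le_mul_of_nonneg_left (h z hz) (norm_nonneg w)).trans_lt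
      (mul_lt_of_lt_one_left (norm_pos_iff.2 hden) hw)
  rw [← norm_mul, ← heq] at hlt
  exact hlt.false

/-- The set `{x ∈ 𝔼̄ : |x₃| = 1}` in its parametrised form `x₁ = x̄₂ x₃`, `|x₂| ≤ 1`, `|x₃| = 1`.
It turns out to be the distinguished boundary of the closed tetrablock. -/
def tetraTorus : Set (ℂ × ℂ × ℂ) :=
  {x | x.1 = conj x.2.1 * x.2.2 ∧ ‖x.2.2‖ = 1 ∧ ‖x.2.1‖ ≤ 1}

theorem snd_eq_of_mem_tetraTorus {x : ℂ × ℂ × ℂ} (hx : x ∈ tetraTorus) :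
    x.2.1 = conj x.1 * x.2.2 := by
  rw [hx.1, map_mul, conj_conj]
  linear_combination -x.2.1 * mul_conj_eq_one_of_norm_eq_one hx.2.1

theorem norm_fst_of_mem_tetraTorus {x : ℂ × ℂ × ℂ} (hx : x ∈ tetraTorus) : ‖x.1‖ = ‖x.2.1‖ := by
  rw [hx.1, norm_mul, hx.2.1, RCLike.norm_conj, mul_one]

theorem norm_fst_le_one_of_mem_tetraTorus {x : ℂ × ℂ × ℂ} (hx : x ∈ tetraTorus) : ‖x.1‖ ≤ 1 :=
  (norm_fst_of_mem_tetraTorus hx).trans_le hx.2.2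

theorem norm_sub_conj_le_norm_one_sub_mul {a z : ℂ} (ha : ‖a‖ ≤ 1) (hz : ‖z‖ ≤ 1) :
    ‖z - conj a‖ ≤ ‖1 - a * z‖ := by
  have hdiff : ‖1 - a * z‖ ^ 2 - ‖z - conj a‖ ^ 2 = (1 - ‖a‖ ^ 2) * (1 - ‖z‖ ^ 2) := by
    apply ofReal_injective
    push_cast
    simp only [← mul_conj', map_sub, map_one, map_mul, conj_conj]
    ring
  have hnonneg : 0 ≤ (1 - ‖a‖ ^ 2) * (1 - ‖z‖ ^ 2) :=
    mul_nonneg (sub_nonneg.2 (pow_le_one₀ (norm_nonneg a) ha))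
      (sub_nonneg.2 (pow_le_one₀ (norm_nonneg z) hz))
  exact pow_le_pow_iff_left₀ (norm_nonneg _) (norm_nonneg _) two_ne_zero |>.1 (by linarith)

theorem norm_sub_mul_le_of_mem_tetraTorus {x : ℂ × ℂ × ℂ} (hx : x ∈ tetraTorus) {z : ℂ}
    (hz : ‖z‖ ≤ 1) : ‖x.2.1 - x.2.2 * z‖ ≤ ‖1 - x.1 * z‖ := by
  have h : x.2.1 - x.2.2 * z = -(x.2.2 * (z - conj x.1)) := by
    linear_combination snd_eq_of_mem_tetraTorus hx
  rw [h, norm_neg, norm_mul, hx.2.1, one_mul]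
  exact norm_sub_conj_le_norm_one_sub_mul (norm_fst_le_one_of_mem_tetraTorus hx) hz

theorem tetraTorus_subset_closure_tetrablock : tetraTorus ⊆ closure tetrablock := fun _ hx =>
  mem_closure_tetrablock_of_norm_sub_mul_le (norm_fst_le_one_of_mem_tetraTorus hx)
    fun _ hz => norm_sub_mul_le_of_mem_tetraTorus hx hz.le

theorem mem_tetraTorus_of_norm_trd_eq_one {x : ℂ × ℂ × ℂ} (hx : x ∈ closure tetrablock)
    (h : ‖x.2.2‖ = 1) : x ∈ tetraTorus := by
  refine ⟨sub_eq_zero.1 (norm_le_zero_iff.1 ?_), h, norm_snd_le_one_of_mem_closure_tetrablock hx⟩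
  have hle := norm_add_norm_le_of_mem_closure_tetrablock hx
  rw [h] at hle
  linarith [norm_nonneg (x.2.1 - conj x.1 * x.2.2)]

theorem isClosed_tetraTorus : IsClosed tetraTorus := by
  have h : tetraTorus = {x | x.1 = conj x.2.1 * x.2.2} ∩ ({x | ‖x.2.2‖ = 1} ∩ {x | ‖x.2.1‖ ≤ 1}) :=
    rfl
  rw [h]
  refine (isClosed_eq ?_ ?_).inter ((isClosed_eq ?_ ?_).inter (isClosed_le ?_ ?_)) <;> fun_prop

theorem isCompact_tetraTorus : IsCompact tetraTorus :=
  (isCompact_closedBall (0 : ℂ × ℂ × ℂ) 1).of_isClosed_subset isClosed_tetraTorus fun _ hx =>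
    mem_closedBall_zero_iff.2
      (norm_le_one_of_mem_closure_tetrablock (tetraTorus_subset_closure_tetrablock hx))

theorem mapsTo_closure_tetrablock_of_circle {f : ℂ → ℂ × ℂ × ℂ} (hf : DiffContOnCl ℂ f unitDisc)
    (hcircle : ∀ l, ‖l‖ = 1 → f l ∈ tetraTorus) :
    MapsTo f closedUnitDisc (closure tetrablock) := by
  have hf₁ : DiffContOnCl ℂ (fun l => (f l).1) unitDisc := differentiable_fst.comp_diffContOnCl hf
  have hf₂ : DiffContOnCl ℂ (fun l => (f l).2.1) unitDisc :=
    (differentiable_fst.comp differentiable_snd).comp_diffContOnCl hf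
  have hf₃ : DiffContOnCl ℂ (fun l => (f l).2.2) unitDisc :=
    (differentiable_snd.comp differentiable_snd).comp_diffContOnCl hf
  have hle {l : ℂ} (hl : ‖l‖ ≤ 1) : ‖(f l).1‖ ≤ 1 :=
    norm_le_of_norm_le_on_circle hf₁
      (fun w hw => norm_fst_le_one_of_mem_tetraTorus (hcircle w hw)) hl
  intro l hl
  rw [mem_closedBall_zero_iff] at hl
  refine mem_closure_tetrablock_of_norm_sub_mul_le (hle hl) fun z hz => ?_
  have hden {l : ℂ} (hl : ‖l‖ ≤ 1) : 1 - (f l).1 * z ≠ 0 := sub_ne_zero.2 fun h => by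
    have hlt : ‖(f l).1 * z‖ < 1 := by
      rw [norm_mul]
      exact (mul_le_of_le_one_left (norm_nonneg z) (hle hl)).trans_lt hz
    simp [← h] at hlt
  have hquot : DiffContOnCl ℂ
      (fun l => (1 - (f l).1 * z)⁻¹ • ((f l).2.1 - (f l).2.2 * z)) unitDisc :=
    (((hf₁.smul_const z).const_sub 1).inv fun w hw => hden <| mem_closedBall_zero_iff.1 <|
      closure_unitDisc.subset hw).smul (hf₂.sub (hf₃.smul_const z))
  have hquot_le := norm_le_of_norm_le_on_circle hquot (M := 1) (fun w hw => by
    rw [norm_smul, norm_inv]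
    exact inv_mul_le_one_of_le₀ (norm_sub_mul_le_of_mem_tetraTorus (hcircle w hw) hz.le)
      (norm_nonneg _)) hl
  rwa [norm_smul, norm_inv, inv_mul_le_one₀ (norm_pos_iff.2 (hden hl))] at hquot_le

/-- The affine disc `l ↦ (b + c̄ l, c + b̄ l, l)`; for `|b| + |c| ≤ 1` it lies in the closed
tetrablock and its boundary lies in `tetraTorus`. These discs sweep out the open tetrablock. -/
noncomputable def tetraDisc (b c : ℂ) (l : ℂ) : ℂ × ℂ × ℂ :=
  (b + conj c * l, c + conj b * l, l)

theorem differentiable_tetraDisc (b c : ℂ) : Differentiable ℂ (tetraDisc b c) := by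
  unfold tetraDisc
  fun_prop

theorem tetraDisc_mem_tetraTorus {b c l : ℂ} (h : ‖b‖ + ‖c‖ ≤ 1) (hl : ‖l‖ = 1) :
    tetraDisc b c l ∈ tetraTorus := by
  refine ⟨?_, hl, ?_⟩
  · simp only [tetraDisc, map_add, map_mul, conj_conj]
    linear_combination -b * mul_conj_eq_one_of_norm_eq_one hl
  · calc ‖c + conj b * l‖ ≤ ‖c‖ + ‖conj b * l‖ := norm_add_le _ _
      _ = ‖b‖ + ‖c‖ := by rw [norm_mul, hl, RCLike.norm_conj, mul_one, add_comm]
      _ ≤ 1 := h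

theorem one_sub_mul_sub_mul_ne_zero {b c z w : ℂ} (h : ‖b‖ + ‖c‖ < 1) (hz : ‖z‖ ≤ 1)
    (hw : ‖w‖ ≤ 1) : 1 - b * z - c * w ≠ 0 := by
  rw [sub_sub, sub_ne_zero]
  intro h1
  have hle : ‖b * z + c * w‖ ≤ ‖b‖ + ‖c‖ := (norm_add_le _ _).trans (by
    rw [norm_mul, norm_mul]
    exact add_le_add (mul_le_of_le_one_right (norm_nonneg b) hz)
      (mul_le_of_le_one_right (norm_nonneg c) hw))
  rw [← h1, norm_one] at hle
  exact (hle.trans_lt h).false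

theorem norm_mul_sub_sub_of_norm_eq_one (b c : ℂ) {z w : ℂ} (hz : ‖z‖ = 1) (hw : ‖w‖ = 1) :
    ‖z * w - conj c * z - conj b * w‖ = ‖1 - b * z - c * w‖ := by
  have h : z * w - conj c * z - conj b * w = z * w * conj (1 - b * z - c * w) := by
    simp only [map_sub, map_one, map_mul]
    linear_combination conj b * w * mul_conj_eq_one_of_norm_eq_one hz
      + conj c * z * mul_conj_eq_one_of_norm_eq_one hw
  rw [h, norm_mul, norm_mul, hz, hw, RCLike.norm_conj, one_mul, one_mul]

theorem norm_mul_sub_sub_le {b c z w : ℂ} (h : ‖b‖ + ‖c‖ < 1) (hz : ‖z‖ ≤ 1) (hw : ‖w‖ ≤ 1) :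
    ‖z * w - conj c * z - conj b * w‖ ≤ ‖1 - b * z - c * w‖ := by
  let f (z w : ℂ) : ℂ := (z * w - conj c * z - conj b * w) / (1 - b * z - c * w)
  have hf_left {w : ℂ} (hw : ‖w‖ ≤ 1) : DiffContOnCl ℂ (fun z => f z w) unitDisc := by
    refine DifferentiableOn.diffContOnCl fun z hz => ?_
    rw [closure_unitDisc, mem_closedBall_zero_iff] at hz
    exact DifferentiableAt.differentiableWithinAt
      (DifferentiableAt.fun_div (by fun_prop) (by fun_prop) (one_sub_mul_sub_mul_ne_zero h hz hw))
  have hf_right {z : ℂ} (hz : ‖z‖ ≤ 1) : DiffContOnCl ℂ (f z) unitDisc := by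
    refine DifferentiableOn.diffContOnCl fun w hw => ?_
    rw [closure_unitDisc, mem_closedBall_zero_iff] at hw
    exact DifferentiableAt.differentiableWithinAt
      (DifferentiableAt.fun_div (by fun_prop) (by fun_prop) (one_sub_mul_sub_mul_ne_zero h hz hw))
  have hcircle {w : ℂ} (hw : ‖w‖ = 1) {z : ℂ} (hz : ‖z‖ ≤ 1) : ‖f z w‖ ≤ 1 := by
    refine norm_le_of_norm_le_on_circle (hf_left hw.le) (fun z hz => ?_) hz
    rw [norm_div, norm_mul_sub_sub_of_norm_eq_one b c hz hw]
    exact div_self_le_one _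
  have hle : ‖f z w‖ ≤ 1 :=
    norm_le_of_norm_le_on_circle (hf_right hz) (fun w hw => hcircle hw hz) hw
  rwa [norm_div, div_le_one (norm_pos_iff.2 (one_sub_mul_sub_mul_ne_zero h hz hw))] at hle

theorem tetraDisc_mem_tetrablock {b c l : ℂ} (h : ‖b‖ + ‖c‖ < 1) (hl : ‖l‖ < 1) :
    tetraDisc b c l ∈ tetrablock := by
  intro z w hz hw h0
  have heq : 1 - b * z - c * w = -(l * (z * w - conj c * z - conj b * w)) := by
    simp only [tetraDisc] at h0
    linear_combination h0
  have hpos : 0 < ‖1 - b * z - c * w‖ := norm_pos_iff.2 (one_sub_mul_sub_mul_ne_zero h hz hw)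
  have hlt : ‖l‖ * ‖z * w - conj c * z - conj b * w‖ < ‖1 - b * z - c * w‖ :=
    (mul_le_mul_of_nonneg_left (norm_mul_sub_sub_le h hz hw) (norm_nonneg l)).trans_lt
      (mul_lt_of_lt_one_left hpos hl)
  rw [← norm_mul, ← norm_neg, ← heq] at hlt
  exact hlt.false

theorem exists_eq_tetraDisc {x : ℂ × ℂ × ℂ} (hx : ‖x.2.2‖ < 1) :
    ∃ b c : ℂ, x = tetraDisc b c x.2.2 ∧ (1 - ‖x.2.2‖ ^ 2) * (‖b‖ + ‖c‖)
      = ‖x.1 - conj x.2.1 * x.2.2‖ + ‖x.2.1 - conj x.1 * x.2.2‖ := by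
  have hpos : 0 < 1 - ‖x.2.2‖ ^ 2 := sub_pos.2 (pow_lt_one₀ (norm_nonneg _) hx two_ne_zero)
  generalize hr : 1 - ‖x.2.2‖ ^ 2 = r at hpos ⊢
  have hr0 : (r : ℂ) ≠ 0 := ofReal_ne_zero.2 hpos.ne'
  have hrc : (r : ℂ) = 1 - x.2.2 * conj x.2.2 := by
    rw [mul_conj', ← hr]
    push_cast
    rfl
  refine ⟨(x.1 - conj x.2.1 * x.2.2) / r, (x.2.1 - conj x.1 * x.2.2) / r, ?_, ?_⟩
  · simp only [tetraDisc, map_div₀, map_sub, map_mul, conj_conj, conj_ofReal]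
    refine Prod.ext ?_ (Prod.ext ?_ rfl) <;> field_simp <;> rw [hrc] <;> ring
  · rw [norm_div, norm_div, norm_real, Real.norm_of_nonneg hpos.le]
    field_simp

theorem exists_eq_tetraDisc_of_mem_tetrablock {x : ℂ × ℂ × ℂ} (hx : x ∈ tetrablock) :
    ∃ b c : ℂ, x = tetraDisc b c x.2.2 ∧ ‖b‖ + ‖c‖ < 1 := by
  have hx₃ := norm_trd_lt_one_of_mem_tetrablock hx
  obtain ⟨b, c, hbc, heq⟩ := exists_eq_tetraDisc hx₃
  have hpos : 0 < 1 - ‖x.2.2‖ ^ 2 := sub_pos.2 (pow_lt_one₀ (norm_nonneg _) hx₃ two_ne_zero)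
  refine ⟨b, c, hbc, lt_of_mul_lt_mul_left ?_ hpos.le⟩
  rw [heq, mul_one]
  exact norm_add_norm_lt_of_mem_tetrablock hx

theorem exists_eq_tetraDisc_of_mem_closure_tetrablock {x : ℂ × ℂ × ℂ}
    (hx : x ∈ closure tetrablock) (hx₃ : ‖x.2.2‖ < 1) :
    ∃ b c : ℂ, x = tetraDisc b c x.2.2 ∧ ‖b‖ + ‖c‖ ≤ 1 := by
  obtain ⟨b, c, hbc, heq⟩ := exists_eq_tetraDisc hx₃
  have hpos : 0 < 1 - ‖x.2.2‖ ^ 2 := sub_pos.2 (pow_lt_one₀ (norm_nonneg _) hx₃ two_ne_zero)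
  refine ⟨b, c, hbc, le_of_mul_le_mul_left ?_ hpos⟩
  rw [heq, mul_one]
  exact norm_add_norm_le_of_mem_closure_tetrablock hx

/-! ### The distinguished boundary -/

theorem norm_le_of_norm_le_on_tetraTorus {f : ℂ × ℂ × ℂ → ℂ}
    (hf : DiffContOnCl ℂ f tetrablock) {M : ℝ} (hM : ∀ y ∈ tetraTorus, ‖f y‖ ≤ M)
    {x : ℂ × ℂ × ℂ} (hx : x ∈ closure tetrablock) : ‖f x‖ ≤ M := by
  suffices h : ∀ y ∈ tetrablock, ‖f y‖ ≤ M from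
    le_on_closure h hf.continuousOn.norm continuousOn_const hx
  intro y hy
  obtain ⟨b, c, hbc, hlt⟩ := exists_eq_tetraDisc_of_mem_tetrablock hy
  have hdisc : DiffContOnCl ℂ (f ∘ tetraDisc b c) unitDisc :=
    hf.comp (differentiable_tetraDisc b c).diffContOnCl
      fun _ hl => tetraDisc_mem_tetrablock hlt (mem_ball_zero_iff.1 hl)
  rw [hbc]
  exact norm_le_of_norm_le_on_circle hdisc
    (fun l hl => hM _ (tetraDisc_mem_tetraTorus hlt.le hl))
    (norm_trd_lt_one_of_mem_tetrablock hy).le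

theorem isClosedBoundary_tetraTorus : IsClosedBoundary tetrablock tetraTorus := by
  refine ⟨isClosed_tetraTorus, tetraTorus_subset_closure_tetrablock, fun f hf => ?_⟩
  obtain ⟨c, hc, hmax⟩ := isCompact_tetraTorus.exists_isMaxOn
    ⟨((0, 0, 1) : ℂ × ℂ × ℂ), by simp [tetraTorus]⟩
    (hf.continuousOn.mono tetraTorus_subset_closure_tetrablock).norm
  exact ⟨c, hc, fun z hz => norm_le_of_norm_le_on_tetraTorus hf (fun y hy => hmax hy) hz⟩

/-- A polynomial in `x` whose modulus on the closed tetrablock is largest exactly at the point `p`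
of `tetraTorus`: on `tetraTorus` it equals `4 + p̄₃ x₃ (4 - |x₂ - p₂|²)`. -/
noncomputable def tetraPeak (p x : ℂ × ℂ × ℂ) : ℂ :=
  4 + conj p.2.2 * (4 * x.2.2 -
    (x.1 * x.2.1 - conj p.2.1 * (x.2.1 * x.2.2) - p.2.1 * x.1 + p.2.1 * conj p.2.1 * x.2.2))

theorem differentiable_tetraPeak (p : ℂ × ℂ × ℂ) : Differentiable ℂ (tetraPeak p) := by
  unfold tetraPeak
  fun_prop

theorem tetraPeak_of_mem_tetraTorus (p : ℂ × ℂ × ℂ) {x : ℂ × ℂ × ℂ} (hx : x ∈ tetraTorus) :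
    tetraPeak p x = 4 + conj p.2.2 * x.2.2 * ((4 - ‖x.2.1 - p.2.1‖ ^ 2 : ℝ) : ℂ) := by
  push_cast
  rw [← mul_conj', tetraPeak, hx.1, map_sub]
  ring

theorem norm_tetraPeak_self {p : ℂ × ℂ × ℂ} (hp : p ∈ tetraTorus) : ‖tetraPeak p p‖ = 8 := by
  rw [tetraPeak_of_mem_tetraTorus p hp, mul_comm (conj p.2.2),
    mul_conj_eq_one_of_norm_eq_one hp.2.1, sub_self, norm_zero]
  norm_num

theorem norm_tetraPeak_add_sq_le {p x : ℂ × ℂ × ℂ} (hp : p ∈ tetraTorus) (hx : x ∈ tetraTorus) :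
    ‖tetraPeak p x‖ + ‖x.2.1 - p.2.1‖ ^ 2 ≤ 8 := by
  have hdist : ‖x.2.1 - p.2.1‖ ≤ 2 := (norm_sub_le _ _).trans (by linarith [hp.2.2, hx.2.2])
  have hnonneg : 0 ≤ 4 - ‖x.2.1 - p.2.1‖ ^ 2 := by
    linarith [pow_le_pow_left₀ (norm_nonneg _) hdist 2]
  have hle : ‖tetraPeak p x‖ ≤ 4 + (4 - ‖x.2.1 - p.2.1‖ ^ 2) := by
    rw [tetraPeak_of_mem_tetraTorus p hx]
    refine (norm_add_le _ _).trans_eq ?_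
    rw [norm_mul, norm_mul, RCLike.norm_conj, hp.2.1, hx.2.1, norm_real,
      Real.norm_of_nonneg hnonneg, one_mul, one_mul, RCLike.norm_ofNat]
  linarith

theorem norm_tetraPeak_le {p x : ℂ × ℂ × ℂ} (hp : p ∈ tetraTorus) (hx : x ∈ tetraTorus) :
    ‖tetraPeak p x‖ ≤ 8 :=
  (le_add_of_nonneg_right (sq_nonneg _)).trans (norm_tetraPeak_add_sq_le hp hx)

theorem eq_of_norm_tetraPeak_eq {p x : ℂ × ℂ × ℂ} (hp : p ∈ tetraTorus) (hx : x ∈ tetraTorus)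
    (h : ‖tetraPeak p x‖ = 8) : x = p := by
  have hx₂ : x.2.1 = p.2.1 := by
    have hsq : ‖x.2.1 - p.2.1‖ ^ 2 ≤ 0 := by linarith [norm_tetraPeak_add_sq_le hp hx]
    exact sub_eq_zero.1 (norm_eq_zero.1 (pow_eq_zero_iff two_ne_zero |>.1
      (hsq.antisymm (sq_nonneg _))))
  have hunit : ‖conj p.2.2 * x.2.2‖ = 1 := by
    rw [norm_mul, RCLike.norm_conj, hp.2.1, hx.2.1, mul_one]
  have hone : 1 = conj p.2.2 * x.2.2 := by
    refine eq_of_norm_eq_of_norm_add_eq (by rw [hunit, norm_one]) ?_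
    have hval : tetraPeak p x = 4 * (1 + conj p.2.2 * x.2.2) := by
      rw [tetraPeak_of_mem_tetraTorus p hx, hx₂, sub_self, norm_zero]
      push_cast
      ring
    rw [hval, norm_mul, RCLike.norm_ofNat] at h
    rw [hunit, norm_one]
    linarith
  have hx₃ : x.2.2 = p.2.2 := by
    linear_combination -p.2.2 * hone - x.2.2 * mul_conj_eq_one_of_norm_eq_one hp.2.1
  exact Prod.ext (by rw [hx.1, hp.1, hx₂, hx₃]) (Prod.ext hx₂ hx₃)

theorem eq_of_le_norm_tetraPeak {p x : ℂ × ℂ × ℂ} (hp : p ∈ tetraTorus)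
    (hx : x ∈ closure tetrablock) (h : 8 ≤ ‖tetraPeak p x‖) : x = p := by
  rcases (norm_trd_le_one_of_mem_closure_tetrablock hx).lt_or_eq with hx₃ | hx₃
  · exfalso
    obtain ⟨b, c, hbc, hle⟩ := exists_eq_tetraDisc_of_mem_closure_tetrablock hx hx₃
    have hdisc : DiffContOnCl ℂ (tetraPeak p ∘ tetraDisc b c) unitDisc :=
      ((differentiable_tetraPeak p).comp (differentiable_tetraDisc b c)).diffContOnCl
    have hconst (l : ℂ) (hl : ‖l‖ = 1) : tetraDisc b c l = p :=
      eq_of_norm_tetraPeak_eq hp (tetraDisc_mem_tetraTorus hle hl) <|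
        norm_eq_on_circle_of_le_norm hdisc
          (fun w hw => norm_tetraPeak_le hp (tetraDisc_mem_tetraTorus hle hw)) hx₃ (by
            rwa [Function.comp_apply, ← hbc]) hl
    have hne := congrArg (fun y => y.2.2)
      ((hconst 1 norm_one).trans (hconst (-1) (by rw [norm_neg, norm_one])).symm)
    norm_num [tetraDisc] at hne
  · have hx' := mem_tetraTorus_of_norm_trd_eq_one hx hx₃
    exact eq_of_norm_tetraPeak_eq hp hx' ((norm_tetraPeak_le hp hx').antisymm h)

theorem tetraBoundary_eq_tetraTorus : tetraBoundary = tetraTorus := by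
  refine (sInter_subset_of_mem isClosedBoundary_tetraTorus).antisymm fun p hp C hC => ?_
  obtain ⟨c, hc, hmax⟩ := hC.2.2 (tetraPeak p) (differentiable_tetraPeak p).diffContOnCl
  have h := hmax p (tetraTorus_subset_closure_tetrablock hp)
  rw [norm_tetraPeak_self hp] at h
  rwa [← eq_of_le_norm_tetraPeak hp (hC.2.1 hc) h]

/-! ### The fundamental group of the distinguished boundary -/

theorem bijective_fundamentalGroup_map_of_homotopyEquiv {X Y : Type*} [TopologicalSpace X]
    [TopologicalSpace Y] (e : X ≃ₕ Y) (x : X) :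
    Function.Bijective (FundamentalGroup.map e.toFun x) :=
  ((FundamentalGroupoidFunctor.equivOfHomotopyEquiv e).fullyFaithfulFunctor.homEquiv
    (X := FundamentalGroupoid.mk x) (Y := FundamentalGroupoid.mk x)).bijective

/-- The isomorphism `n ↦ n • a` of `ℤ` with the group of multiples of an element `a` of infinite
order; for `a = 2π` it identifies the deck transformation group of `Circle.exp`. -/
noncomputable def intEquivZMultiples {A : Type*} [AddGroup A] {a : A} (ha : ¬IsOfFinAddOrder a) :
    ℤ ≃+ AddSubgroup.zmultiples a :=
  AddEquiv.ofBijective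
    ((zmultiplesHom A a).codRestrict (AddSubgroup.zmultiples a) fun n => ⟨n, rfl⟩)
    ⟨fun _ _ h => injective_zsmul_iff_not_isOfFinAddOrder.2 ha (congrArg Subtype.val h),
      fun ⟨_, n, hn⟩ => ⟨n, Subtype.ext hn⟩⟩

theorem not_isOfFinAddOrder_two_pi : ¬IsOfFinAddOrder (2 * Real.pi) :=
  not_isOfFinAddOrder_of_isAddTorsionFree Real.two_pi_pos.ne'

/-- The isomorphism of `π₁(𝕋, x)` with `ℤ`, multiplicatively written, that sends a loop to its
winding number. It is built from the universal covering `Circle.exp`, by means of a point `e` over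
the base point. -/
noncomputable def circleWindingEquiv {x : Circle} (e : Circle.exp ⁻¹' {x}) :
    FundamentalGroup Circle x ≃* Multiplicative ℤ :=
  (Circle.isAddQuotientCoveringMap_exp.fundamentalGroupEquiv e).trans
    (MulOpposite.opMulEquiv.symm.trans
      (intEquivZMultiples not_isOfFinAddOrder_two_pi).toMultiplicative.symm)

theorem circleWindingEquiv_fromPath {x : Circle} {γ : Path x x} {Γ : C(unitInterval, ℝ)}
    (hΓ : ∀ t, Circle.exp (Γ t) = γ t) {m : ℤ} (hm : Γ 1 = Γ 0 + m * (2 * Real.pi)) :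
    circleWindingEquiv ⟨Γ 0, (hΓ 0).trans γ.source⟩
      (FundamentalGroup.fromPath (Path.Homotopic.Quotient.mk γ)) = Multiplicative.ofAdd m := by
  have hlift : Γ = Circle.isCoveringMap_exp.liftPath γ (Γ 0) (hΓ 0).symm :=
    (Circle.isCoveringMap_exp.eq_liftPath_iff' _).2 ⟨funext hΓ, rfl⟩
  have hdeck : Circle.isAddQuotientCoveringMap_exp.fundamentalGroupEquiv
      ⟨Γ 0, (hΓ 0).trans γ.source⟩ (FundamentalGroup.fromPath (Path.Homotopic.Quotient.mk γ))
      = MulOpposite.op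
        (Multiplicative.ofAdd (intEquivZMultiples not_isOfFinAddOrder_two_pi m)) := by
    refine Circle.isAddQuotientCoveringMap_exp.fundamentalGroupToMulOpposite_apply_eq_Iff.2 ?_
    calc m • (2 * Real.pi) + Γ 0 = Γ 1 := by rw [hm, zsmul_eq_mul, add_comm]
      _ = Circle.isCoveringMap_exp.liftPath γ (Γ 0) (hΓ 0).symm 1 := congrArg (· 1) hlift
  rw [circleWindingEquiv, MulEquiv.trans_apply, hdeck]
  exact congrArg Multiplicative.ofAdd
    ((intEquivZMultiples not_isOfFinAddOrder_two_pi).symm_apply_apply m)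

theorem mem_tetraTorus_of_mem_tetraBoundary (x : tetraBoundary) : (x : ℂ × ℂ × ℂ) ∈ tetraTorus :=
  tetraBoundary_eq_tetraTorus ▸ x.2

/-- The third coordinate, as a map from the distinguished boundary to the circle. -/
noncomputable def tetraThird : C(tetraBoundary, Circle) where
  toFun x := ⟨(x : ℂ × ℂ × ℂ).2.2,
    mem_sphere_zero_iff_norm.2 (mem_tetraTorus_of_mem_tetraBoundary x).2.1⟩
  continuous_toFun := by fun_prop

/-- The embedding `z ↦ (0, 0, z)` of the circle as the core of the solid torus `tetraBoundary`. -/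
noncomputable def tetraCore : C(Circle, tetraBoundary) where
  toFun z := ⟨(0, 0, (z : ℂ)), tetraBoundary_eq_tetraTorus.ge
    ⟨by rw [map_zero, zero_mul], Circle.norm_coe z, norm_zero.trans_le zero_le_one⟩⟩
  continuous_toFun := by fun_prop

/-- The deformation retraction `(t x₁, t x₂, x₃)` of the distinguished boundary onto its core. -/
noncomputable def tetraShrink : (tetraCore.comp tetraThird).Homotopy (ContinuousMap.id _) where
  toFun p := ⟨(((p.1 : ℝ) : ℂ) * (p.2 : ℂ × ℂ × ℂ).1, ((p.1 : ℝ) : ℂ) * (p.2 : ℂ × ℂ × ℂ).2.1,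
    (p.2 : ℂ × ℂ × ℂ).2.2), by
      have h := mem_tetraTorus_of_mem_tetraBoundary p.2
      refine tetraBoundary_eq_tetraTorus.ge ⟨?_, h.2.1, ?_⟩
      · rw [map_mul, conj_ofReal, h.1, mul_assoc]
      · rw [norm_mul, norm_real, Real.norm_of_nonneg p.1.2.1]
        exact mul_le_one₀ p.1.2.2 (norm_nonneg _) h.2.2⟩
  continuous_toFun := by fun_prop
  map_zero_left x := by
    refine Subtype.ext (Prod.ext ?_ (Prod.ext ?_ rfl)) <;> simp [tetraCore]
  map_one_left x := by ext <;> simp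

/-- The homotopy equivalence of the distinguished boundary with the circle given by the third
coordinate. -/
noncomputable def tetraHomotopyEquiv : tetraBoundary ≃ₕ Circle where
  toFun := tetraThird
  invFun := tetraCore
  left_inv := ⟨tetraShrink⟩
  right_inv := .refl _

theorem exists_tetraBoundary_mulEquiv (g : C(Circle, tetraBoundary))
    (Γ : C(unitInterval, ℝ)) (m : ℤ)
    (hΓ : ∀ t : unitInterval, (Circle.exp (Γ t) : ℂ)
      = (g (Circle.exp (2 * Real.pi * (t : ℝ))) : ℂ × ℂ × ℂ).2.2)
    (hm : Γ 1 = Γ 0 + m * (2 * Real.pi)) :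
    ∃ φ : FundamentalGroup tetraBoundary (g 1) ≃* Multiplicative ℤ,
      φ (FundamentalGroup.map g 1 circleGenerator) = Multiplicative.ofAdd m := by
  let γ : Path (tetraThird (g 1)) (tetraThird (g 1)) :=
    (circleLoop.map g.continuous).map tetraThird.continuous
  have hγ (t : unitInterval) : Circle.exp (Γ t) = γ t := Subtype.ext (hΓ t)
  exact ⟨(MulEquiv.ofBijective _
    (bijective_fundamentalGroup_map_of_homotopyEquiv tetraHomotopyEquiv (g 1))).trans
      (circleWindingEquiv ⟨Γ 0, (hγ 0).trans γ.source⟩), circleWindingEquiv_fromPath hγ hm⟩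

theorem natCast_eq_of_multiplicative_int_mulEquiv {φ : Multiplicative ℤ ≃* Multiplicative ℤ}
    {m n : ℕ} (h : φ (Multiplicative.ofAdd (m : ℤ)) = Multiplicative.ofAdd (n : ℤ)) : m = n := by
  have hadd : AddEquiv.toMultiplicative.symm φ (m : ℤ) = n := h
  rcases Int.addEquiv_eq_refl_or_neg (AddEquiv.toMultiplicative.symm φ) with hφ | hφ
  · rw [hφ, AddEquiv.refl_apply] at hadd
    exact_mod_cast hadd
  · rw [hφ, AddEquiv.neg_apply] at hadd
    omega

theorem hasTetraDegree_unique {x : ℂ → ℂ × ℂ × ℂ} {m n : ℕ} (hm : HasTetraDegree x m)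
    (hn : HasTetraDegree x n) : m = n := by
  obtain ⟨g, hg, φ, hφ⟩ := hm
  obtain ⟨g', hg', ψ, hψ⟩ := hn
  obtain rfl : g = g' := by
    ext1 ζ
    exact Subtype.ext (tendsto_nhds_unique (hg ζ) (hg' ζ))
  refine natCast_eq_of_multiplicative_int_mulEquiv (φ := φ.symm.trans ψ) ?_
  rw [MulEquiv.trans_apply, ← hφ, MulEquiv.symm_apply_apply, hψ]

/-! ### Reflection of polynomials in the circle -/

theorem conjReflect_mul {m n : ℕ} {f g : ℂ[X]} (hf : f.natDegree ≤ m) (hg : g.natDegree ≤ n) :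
    conjReflect (m + n) (f * g) = conjReflect m f * conjReflect n g := by
  rw [conjReflect, Polynomial.map_mul, reflect_mul _ _ (natDegree_map_le.trans hf)
    (natDegree_map_le.trans hg)]
  rfl

theorem conjReflect_C_mul (n : ℕ) (c : ℂ) (f : ℂ[X]) :
    conjReflect n (C c * f) = C (conj c) * conjReflect n f := by
  rw [conjReflect, Polynomial.map_mul, map_C, reflect_C_mul]
  rfl

theorem conjReflect_conjReflect (n : ℕ) (f : ℂ[X]) : conjReflect n (conjReflect n f) = f := by
  ext k
  simp [conjReflect, coeff_reflect, coeff_map]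

theorem conjReflect_ne_zero (n : ℕ) {f : ℂ[X]} (hf : f ≠ 0) : conjReflect n f ≠ 0 := fun h =>
  hf <| by rw [← conjReflect_conjReflect n f, h, conjReflect, Polynomial.map_zero, reflect_zero]

theorem natDegree_conjReflect_le {n : ℕ} {f : ℂ[X]} (hf : f.natDegree ≤ n) :
    (conjReflect n f).natDegree ≤ n :=
  natDegree_reflect_le.trans (max_le le_rfl (natDegree_map_le.trans hf))

theorem eval_conjReflect_of_norm_eq_one {n : ℕ} {f : ℂ[X]} (hf : f.natDegree ≤ n) {z : ℂ}
    (hz : ‖z‖ = 1) : (conjReflect n f).eval z = z ^ n * conj (f.eval z) := by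
  have hz0 : z ≠ 0 := norm_ne_zero_iff.1 (hz ▸ one_ne_zero)
  have hinv : 1 / conj z = z := by
    rw [div_eq_iff ((_root_.map_ne_zero _).2 hz0), mul_conj_eq_one_of_norm_eq_one hz]
  rw [eval_conjReflect n f hf z hz0, hinv]

theorem norm_eval_conjReflect {n : ℕ} {f : ℂ[X]} (hf : f.natDegree ≤ n) {z : ℂ}
    (hz : ‖z‖ = 1) : ‖(conjReflect n f).eval z‖ = ‖f.eval z‖ := by
  rw [eval_conjReflect_of_norm_eq_one hf hz, norm_mul, norm_pow, hz, one_pow, one_mul,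
    RCLike.norm_conj]

theorem eq_of_eval_eq_on_circle {p q : ℂ[X]} (h : ∀ z : ℂ, ‖z‖ = 1 → p.eval z = q.eval z) :
    p = q :=
  eq_of_infinite_eval_eq p q <|
    infinite_unit_sphere.mono fun z hz => h z (mem_sphere_zero_iff_norm.1 hz)

theorem eq_conjReflect_iff {n : ℕ} {f g : ℂ[X]} (hg : g.natDegree ≤ n) :
    f = conjReflect n g ↔ ∀ z : ℂ, ‖z‖ = 1 → f.eval z = z ^ n * conj (g.eval z) := by
  constructor
  · rintro rfl z hz
    exact eval_conjReflect_of_norm_eq_one hg hz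
  · exact fun h => eq_of_eval_eq_on_circle fun z hz => by
      rw [h z hz, eval_conjReflect_of_norm_eq_one hg hz]

theorem natDegree_le_of_eval_eq_pow_mul_conj {n : ℕ} {f g : ℂ[X]}
    (h : ∀ z : ℂ, ‖z‖ = 1 → f.eval z = z ^ n * conj (g.eval z)) : f.natDegree ≤ n := by
  have hreflect : X ^ g.natDegree * f = conjReflect (g.natDegree + n) g :=
    (eq_conjReflect_iff (Nat.le_add_right _ _)).2 fun z hz => by
      rw [eval_mul, eval_pow, eval_X, h z hz, pow_add, mul_assoc]
  rw [natDegree_le_iff_coeff_eq_zero]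
  intro j hj
  rw [← coeff_X_pow_mul f g.natDegree j, hreflect, conjReflect, coeff_reflect, coeff_map,
    revAt_eq_self_of_lt (by omega), coeff_eq_zero_of_natDegree_lt (by omega), map_zero]

theorem isCoprime_of_forall_eval_ne_zero {p q : ℂ[X]}
    (h : ∀ z : ℂ, p.eval z = 0 → q.eval z ≠ 0) : IsCoprime p q := by
  rw [Polynomial.isCoprime_iff_aeval_ne_zero_of_isAlgClosed ℂ ℂ]
  intro z
  simp only [coe_aeval_eq_eval]
  exact or_iff_not_imp_left.2 fun hz => h z (not_not.1 hz)

theorem eval_conjReflect_ne_zero {n : ℕ} {q : ℂ[X]} (hn : q.natDegree ≤ n)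
    (hq : ∀ z ∈ closedUnitDisc, q.eval z ≠ 0) {z : ℂ} (hz : 1 ≤ ‖z‖) :
    (conjReflect n q).eval z ≠ 0 := by
  have hz0 : z ≠ 0 := norm_pos_iff.1 (one_pos.trans_le hz)
  have hinv : 1 / conj z ∈ closedUnitDisc := by
    rw [mem_closedBall_zero_iff, norm_div, norm_one, RCLike.norm_conj]
    exact div_le_one_of_le₀ hz (norm_nonneg _)
  rw [eval_conjReflect n q hn z hz0]
  exact mul_ne_zero (pow_ne_zero n hz0) ((_root_.map_ne_zero _).2 (hq _ hinv))

theorem isCoprime_conjReflect {n : ℕ} {p q : ℂ[X]} (hn : q.natDegree ≤ n)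
    (hp : ∀ z ∈ closedUnitDisc, p.eval z ≠ 0) (hq : ∀ z ∈ closedUnitDisc, q.eval z ≠ 0) :
    IsCoprime p (conjReflect n q) :=
  isCoprime_of_forall_eval_ne_zero fun z hz => eval_conjReflect_ne_zero hn hq <|
    le_of_not_ge fun hle => hp z (mem_closedBall_zero_iff.2 hle) hz

theorem mul_conjReflect_eq_of_norm_eq {n : ℕ} {p q : ℂ[X]} (hp : p.natDegree ≤ n)
    (hq : q.natDegree ≤ n) (h : ∀ z : ℂ, ‖z‖ = 1 → ‖p.eval z‖ = ‖q.eval z‖) :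
    p * conjReflect n p = q * conjReflect n q :=
  eq_of_eval_eq_on_circle fun z hz => by
    rw [eval_mul, eval_mul, eval_conjReflect_of_norm_eq_one hp hz,
      eval_conjReflect_of_norm_eq_one hq hz, mul_left_comm, mul_left_comm (q.eval z), mul_conj',
      mul_conj', h z hz]

theorem exists_eq_C_mul_conjReflect_of_norm_eq {p q : ℂ[X]} (hpq : IsCoprime p q)
    (h : ∀ z : ℂ, ‖z‖ = 1 → ‖p.eval z‖ = ‖q.eval z‖) :
    ∃ (N : ℕ) (c : ℂ), ‖c‖ = 1 ∧ q.natDegree ≤ N ∧ p = C c * conjReflect N q := by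
  set N := max p.natDegree q.natDegree
  have hpN : p.natDegree ≤ N := le_max_left _ _
  have hqN : q.natDegree ≤ N := le_max_right _ _
  have hp0 : p ≠ 0 := by
    rintro rfl
    obtain rfl : q = 0 := eq_of_eval_eq_on_circle fun z hz => by
      rw [eval_zero, ← norm_eq_zero, ← h z hz, eval_zero, norm_zero]
    exact not_isCoprime_zero_zero hpq
  have hmul := mul_conjReflect_eq_of_norm_eq hpN hqN h
  obtain ⟨k, hk⟩ : q ∣ conjReflect N p := hpq.symm.dvd_of_dvd_mul_left ⟨_, hmul⟩
  have hqk0 : q * k ≠ 0 := hk ▸ conjReflect_ne_zero N hp0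
  have hk' : p * k = conjReflect N q :=
    mul_left_cancel₀ (left_ne_zero_of_mul hqk0) (by rw [← hmul, hk]; ring)
  have hdegk : k.natDegree ≤ 0 := by
    have hqk := natDegree_conjReflect_le hpN
    have hpk := natDegree_conjReflect_le hqN
    rw [hk, natDegree_mul (left_ne_zero_of_mul hqk0) (right_ne_zero_of_mul hqk0)] at hqk
    rw [← hk', natDegree_mul hp0 (right_ne_zero_of_mul hqk0)] at hpk
    omega
  obtain ⟨c, rfl⟩ : ∃ c, k = C c := ⟨_, eq_C_of_natDegree_le_zero hdegk⟩
  have hp : C (conj c) * conjReflect N q = p := by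
    rw [← conjReflect_C_mul, mul_comm, ← hk, conjReflect_conjReflect]
  have hcc : C (conj c * c) * p = C 1 * p := by
    rw [C_mul, mul_assoc, mul_comm _ p, hk', hp, C_1, one_mul]
  refine ⟨N, conj c, ?_, hqN, hp.symm⟩
  rw [RCLike.norm_conj, ← pow_eq_one_iff_of_nonneg (norm_nonneg c) two_ne_zero]
  exact_mod_cast (conj_mul' c).symm.trans (C_injective (mul_right_cancel₀ hp0 hcc))

theorem exists_C_mul_eq_conjReflect_of_norm_eq {p q : ℂ[X]} (hpq : IsCoprime p q)
    (h : ∀ z : ℂ, ‖z‖ = 1 → ‖p.eval z‖ = ‖q.eval z‖) :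
    ∃ (N : ℕ) (u : ℂ), ‖u‖ = 1 ∧ q.natDegree ≤ N ∧ C u * p = conjReflect N (C u * q) := by
  obtain ⟨N, c, hc, hN, rfl⟩ := exists_eq_C_mul_conjReflect_of_norm_eq hpq h
  obtain ⟨u, hu, huc⟩ := exists_norm_eq_one_mul_eq_conj hc
  refine ⟨N, u, hu, hN, ?_⟩
  rw [conjReflect_C_mul, ← huc, ← mul_assoc, ← C_mul, mul_comm u c]

theorem dvd_of_div_eq_pow_mul_conj_div {N : ℕ} {p q r s : ℂ[X]}
    (hq : ∀ z ∈ closedUnitDisc, q.eval z ≠ 0) (hs : ∀ z ∈ closedUnitDisc, s.eval z ≠ 0)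
    (h : ∀ z : ℂ, ‖z‖ = 1 → p.eval z / q.eval z = z ^ N * conj (r.eval z / s.eval z)) :
    q ∣ p := by
  set M := max r.natDegree s.natDegree
  have hrM : r.natDegree ≤ M := le_max_left _ _
  have hsM : s.natDegree ≤ M := le_max_right _ _
  have hmul : p * conjReflect M s = q * (X ^ N * conjReflect M r) :=
    eq_of_eval_eq_on_circle fun z hz => by
      have hz' : z ∈ closedUnitDisc := mem_closedBall_zero_iff.2 hz.le
      have hs' : conj (s.eval z) ≠ 0 := (_root_.map_ne_zero _).2 (hs z hz')
      have hcross := h z hz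
      rw [map_div₀, mul_div_assoc', div_eq_div_iff (hq z hz') hs'] at hcross
      rw [eval_mul, eval_mul, eval_mul, eval_pow, eval_X, eval_conjReflect_of_norm_eq_one hrM hz,
        eval_conjReflect_of_norm_eq_one hsM hz]
      linear_combination z ^ M * hcross
  exact (isCoprime_conjReflect hsM hq hs).dvd_of_dvd_mul_right ⟨_, hmul⟩

theorem exists_eq_mul_and_eq_conjReflect_mul {N : ℕ} {p q r s : ℂ[X]}
    (hq : ∀ z ∈ closedUnitDisc, q.eval z ≠ 0) (hs : ∀ z ∈ closedUnitDisc, s.eval z ≠ 0)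
    (h : ∀ z : ℂ, ‖z‖ = 1 → p.eval z / q.eval z = z ^ N * conj (r.eval z / s.eval z)) :
    ∃ E : ℂ[X], E.natDegree ≤ N ∧ p = q * conjReflect N E ∧ r = s * E := by
  have hsymm : ∀ {z v w : ℂ}, ‖z‖ = 1 → v = z ^ N * conj w → w = z ^ N * conj v := by
    rintro z v w hz rfl
    have hpow : z ^ N * conj (z ^ N) = 1 :=
      mul_conj_eq_one_of_norm_eq_one (by rw [norm_pow, hz, one_pow])
    rw [map_mul, conj_conj, ← mul_assoc, hpow, one_mul]
  obtain ⟨F, rfl⟩ := dvd_of_div_eq_pow_mul_conj_div hq hs h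
  obtain ⟨E, rfl⟩ := dvd_of_div_eq_pow_mul_conj_div hs hq fun z hz => hsymm hz (h z hz)
  have hFE : ∀ z : ℂ, ‖z‖ = 1 → F.eval z = z ^ N * conj (E.eval z) := fun z hz => by
    have hz' : z ∈ closedUnitDisc := mem_closedBall_zero_iff.2 hz.le
    simpa only [eval_mul, mul_div_cancel_left₀ _ (hq z hz'), mul_div_cancel_left₀ _ (hs z hz')]
      using h z hz
  have hdeg : E.natDegree ≤ N :=
    natDegree_le_of_eval_eq_pow_mul_conj fun z hz => hsymm hz (hFE z hz)
  exact ⟨E, hdeg, by rw [(eq_conjReflect_iff hdeg).2 hFE], rfl⟩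

/-! ### Boundary values of rational functions on the disc -/

theorem norm_eval_le_on_closedUnitDisc {p q : ℂ[X]}
    (h : ∀ z ∈ unitDisc, ‖p.eval z‖ ≤ ‖q.eval z‖) {z : ℂ} (hz : z ∈ closedUnitDisc) :
    ‖p.eval z‖ ≤ ‖q.eval z‖ :=
  le_on_closure h p.continuous.norm.continuousOn q.continuous.norm.continuousOn
    (closure_unitDisc.superset hz)

theorem IsRationalOnDisc.exists_isCoprime {f : ℂ → ℂ} (hf : IsRationalOnDisc f) :
    ∃ p q : ℂ[X], IsCoprime p q ∧ ∀ z ∈ unitDisc, q.eval z ≠ 0 ∧ f z = p.eval z / q.eval z := by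
  obtain ⟨p, q, h⟩ := hf
  have hq0 : q ≠ 0 := by
    rintro rfl
    exact (h 0 (Metric.mem_ball_self one_pos)).1 eval_zero
  obtain ⟨p, q, g, hpq, rfl, rfl⟩ := UniqueFactorizationMonoid.exists_reduced_factors' p q hq0
  refine ⟨p, q, hpq.isCoprime, fun z hz => ?_⟩
  obtain ⟨hqz, hfz⟩ := h z hz
  rw [eval_mul] at hqz
  rw [hfz, eval_mul, eval_mul, mul_div_mul_left _ _ (left_ne_zero_of_mul hqz)]
  exact ⟨right_ne_zero_of_mul hqz, rfl⟩

theorem IsRationalOnDisc.exists_isCoprime_of_norm_le {f : ℂ → ℂ} (hf : IsRationalOnDisc f) {M : ℝ}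
    (hM : ∀ z ∈ unitDisc, ‖f z‖ ≤ M) :
    ∃ p q : ℂ[X], IsCoprime p q ∧ (∀ z ∈ closedUnitDisc, q.eval z ≠ 0) ∧
      ∀ z ∈ unitDisc, f z = p.eval z / q.eval z := by
  obtain ⟨p, q, hpq, h⟩ := hf.exists_isCoprime
  refine ⟨p, q, hpq, fun z hz hqz => ?_, fun z hz => (h z hz).2⟩
  have hle : ‖p.eval z‖ ≤ ‖(C (M : ℂ) * q).eval z‖ :=
    norm_eval_le_on_closedUnitDisc (fun w hw => by
      have hfw := hM w hw
      rw [(h w hw).2, norm_div, div_le_iff₀ (norm_pos_iff.2 (h w hw).1)] at hfw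
      rw [eval_mul, eval_C, norm_mul, norm_real]
      exact hfw.trans (mul_le_mul_of_nonneg_right (le_abs_self M) (norm_nonneg _))) hz
  rw [eval_mul, hqz, mul_zero, norm_zero, norm_le_zero_iff] at hle
  obtain ⟨a, b, hab⟩ := hpq
  have heval := congrArg (eval z) hab
  rw [eval_add, eval_mul, eval_mul, hle, hqz, mul_zero, mul_zero, add_zero, eval_one] at heval
  exact zero_ne_one heval

theorem extensionEqOnClosedDisc_of_eq_div {f : ℂ → ℂ} {p q : ℂ[X]}
    (hq : ∀ z ∈ closedUnitDisc, q.eval z ≠ 0) (h : ∀ z ∈ unitDisc, f z = p.eval z / q.eval z) :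
    ExtensionEqOnClosedDisc f (fun z => p.eval z / q.eval z) := fun z hz =>
  ((p.continuousAt.div q.continuousAt (hq z hz)).tendsto.mono_left nhdsWithin_le_nhds).congr'
    (eventually_nhdsWithin_of_forall fun w hw => (h w hw).symm)

theorem ExtensionEqOnClosedDisc.eq_on_unitDisc {f g : ℂ → ℂ} (h : ExtensionEqOnClosedDisc f g)
    {z : ℂ} (hz : z ∈ unitDisc) : f z = g z :=
  tendsto_nhds_unique (tendsto_pure_nhds f z)
    ((h z (Metric.ball_subset_closedBall hz)).mono_left (pure_le_nhdsWithin hz))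

theorem tendsto_ofReal_mul_nhdsWithin_unitDisc {z : ℂ} (hz : ‖z‖ = 1) :
    Tendsto (fun r : ℝ => (r : ℂ) * z) (𝓝[<] 1) (𝓝[unitDisc] z) := by
  refine tendsto_nhdsWithin_iff.2 ⟨?_, ?_⟩
  · have hcont : Continuous fun r : ℝ => (r : ℂ) * z := by fun_prop
    exact (hcont.tendsto' 1 z (by rw [ofReal_one, one_mul])).mono_left nhdsWithin_le_nhds
  · filter_upwards [Ioo_mem_nhdsLT (zero_lt_one' ℝ)] with r hr
    rw [mem_ball_zero_iff, norm_mul, hz, mul_one, norm_real, Real.norm_of_nonneg hr.1.le]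
    exact hr.2

theorem tendsto_radial_of_eqOn_unitDisc {Y : Type*} [TopologicalSpace Y] {x y : ℂ → Y}
    (hy : ContinuousOn y closedUnitDisc) (hxy : EqOn x y unitDisc) {z : ℂ} (hz : ‖z‖ = 1) :
    Tendsto (fun r : ℝ => x (r * z)) (𝓝[<] 1) (𝓝 (y z)) := by
  have hyz : Tendsto y (𝓝[unitDisc] z) (𝓝 (y z)) :=
    (hy z (mem_closedBall_zero_iff.2 hz.le)).mono Metric.ball_subset_closedBall
  exact (hyz.congr' (eventually_nhdsWithin_of_forall fun w hw => (hxy hw).symm)).comp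
    (tendsto_ofReal_mul_nhdsWithin_unitDisc hz)

theorem mem_of_ae_mem_of_continuousOn_sphere {Y : Type*} [TopologicalSpace Y] {K : Set Y}
    (hK : IsClosed K) {y : ℂ → Y} (hy : ContinuousOn y (Metric.sphere 0 1))
    (h : ∀ᵐ θ : ℝ ∂(volume.restrict (Ioc 0 (2 * Real.pi))), y (Complex.exp (θ * I)) ∈ K)
    {z : ℂ} (hz : ‖z‖ = 1) : y z ∈ K := by
  have hcont : Continuous fun θ : ℝ => y (Complex.exp (θ * I)) :=
    hy.comp_continuous (by fun_prop)
      fun θ => mem_sphere_zero_iff_norm.2 (norm_exp_ofReal_mul_I θ)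
  have hclosed := hK.preimage hcont
  have hdense := Measure.dense_of_ae (ae_imp_of_ae_restrict h)
  have hsub : Ioc 0 (2 * Real.pi) ⊆ (fun θ : ℝ => y (Complex.exp (θ * I))) ⁻¹' K :=
    calc Ioc 0 (2 * Real.pi) ⊆ closure (Ioo 0 (2 * Real.pi)) := by
          rw [closure_Ioo Real.two_pi_pos.ne]
          exact Ioc_subset_Icc_self
      _ ⊆ (fun θ : ℝ => y (Complex.exp (θ * I))) ⁻¹' K := by
          refine closure_minimal ((hdense.open_subset_closure_inter isOpen_Ioo).trans ?_) hclosed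
          exact closure_minimal (fun θ hθ => hθ.2 (Ioo_subset_Ioc_self hθ.1)) hclosed
  have hper : Function.Periodic (fun θ : ℝ => Complex.exp (θ * I)) (2 * Real.pi) := fun θ => by
    simp only [ofReal_add, ofReal_mul, ofReal_ofNat, add_mul, exp_add, exp_two_pi_mul_I, mul_one]
  obtain ⟨θ, hθ, hθz⟩ := hper.exists_mem_Ioc Real.two_pi_pos z.arg 0
  have hz' : z = Complex.exp (θ * I) := by
    rw [← hθz, ← one_mul (Complex.exp _), ← ofReal_one, ← hz, norm_mul_exp_arg_mul_I]
  rw [zero_add] at hθ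
  exact hz' ▸ hsub hθ

theorem exists_continuous_exp_eq {f : ℂ → ℂ} (hf : ContinuousOn f closedUnitDisc)
    (hf0 : ∀ z ∈ closedUnitDisc, f z ≠ 0) :
    ∃ L : ℂ → ℂ, Continuous L ∧ ∀ z ∈ closedUnitDisc, Complex.exp (L z) = f z := by
  have hpos (z : ℂ) : (0 : ℝ) < max 1 ‖z‖ := lt_max_of_lt_left one_pos
  have hmem (z : ℂ) : z / (max 1 ‖z‖ : ℝ) ∈ closedUnitDisc := by
    rw [mem_closedBall_zero_iff, norm_div, norm_real, Real.norm_of_nonneg (hpos z).le]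
    exact div_le_one_of_le₀ (le_max_right _ _) (hpos z).le
  have hcont : Continuous fun z : ℂ => f (z / (max 1 ‖z‖ : ℝ)) :=
    hf.comp_continuous
      (continuous_id.div (by fun_prop) fun z => ofReal_ne_zero.2 (hpos z).ne') hmem
  have hcontractible : ContractibleSpace (univ : Set ℂ) :=
    convex_univ.contractibleSpace univ_nonempty
  obtain ⟨L, hL, hexp⟩ := Complex.exists_continuousOn_eqOn_exp_comp (X := ℂ) (U := univ)
    (inferInstanceAs (SimplyConnectedSpace (univ : Set ℂ))) isOpen_univ hcont.continuousOn <| by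
      rintro ⟨z, -, hz⟩
      exact hf0 _ (hmem z) hz
  refine ⟨L, continuousOn_univ.1 hL, fun z hz => (hexp (mem_univ z)).trans ?_⟩
  simp only [max_eq_left (mem_closedBall_zero_iff.1 hz), ofReal_one, div_one]

/-! ### Tetra-inner functions from polynomials -/

/-- The pairs of polynomials `E`, `D` of degree at most `n` that parametrise the rational
tetra-inner functions of degree `n`: `D` has no zeros on the closed disc and dominates `E` on
the unit circle. -/
structure IsTetraPair (n : ℕ) (E D : ℂ[X]) : Prop where
  natDegree_left_le : E.natDegree ≤ n
  natDegree_right_le : D.natDegree ≤ n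
  eval_right_ne_zero : ∀ z ∈ closedUnitDisc, D.eval z ≠ 0
  norm_left_le : ∀ z : ℂ, ‖z‖ = 1 → ‖E.eval z‖ ≤ ‖D.eval z‖

/-- The rational map `(E^{∼n} / D, E / D, D^{∼n} / D)` of the disc into `ℂ³`. -/
noncomputable def tetraQuotient (n : ℕ) (E D : ℂ[X]) (z : ℂ) : ℂ × ℂ × ℂ :=
  ((conjReflect n E).eval z / D.eval z, E.eval z / D.eval z, (conjReflect n D).eval z / D.eval z)

namespace IsTetraPair

variable {n : ℕ} {E D : ℂ[X]}

theorem conjReflect_left (h : IsTetraPair n E D) : IsTetraPair n (conjReflect n E) D where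
  natDegree_left_le := natDegree_conjReflect_le h.natDegree_left_le
  natDegree_right_le := h.natDegree_right_le
  eval_right_ne_zero := h.eval_right_ne_zero
  norm_left_le z hz := (norm_eval_conjReflect h.natDegree_left_le hz).trans_le (h.norm_left_le z hz)

theorem diffContOnCl_eval_div (h : IsTetraPair n E D) (p : ℂ[X]) :
    DiffContOnCl ℂ (fun z => p.eval z / D.eval z) unitDisc := by
  refine DifferentiableOn.diffContOnCl fun z hz => ?_
  rw [closure_unitDisc] at hz
  exact (p.differentiableAt.div D.differentiableAt
    (h.eval_right_ne_zero z hz)).differentiableWithinAt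

theorem diffContOnCl_tetraQuotient (h : IsTetraPair n E D) :
    DiffContOnCl ℂ (tetraQuotient n E D) unitDisc :=
  ⟨(h.diffContOnCl_eval_div _).1.prodMk
      ((h.diffContOnCl_eval_div _).1.prodMk (h.diffContOnCl_eval_div _).1),
    (h.diffContOnCl_eval_div _).2.prodMk
      ((h.diffContOnCl_eval_div _).2.prodMk (h.diffContOnCl_eval_div _).2)⟩

theorem continuousOn_tetraQuotient (h : IsTetraPair n E D) :
    ContinuousOn (tetraQuotient n E D) closedUnitDisc :=
  closure_unitDisc ▸ h.diffContOnCl_tetraQuotient.continuousOn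

theorem norm_eval_left_le (h : IsTetraPair n E D) {z : ℂ} (hz : z ∈ closedUnitDisc) :
    ‖E.eval z‖ ≤ ‖D.eval z‖ := by
  have hle := norm_le_of_norm_le_on_circle (h.diffContOnCl_eval_div E) (M := 1) (fun w hw => by
    rw [norm_div]
    exact div_le_one_of_le₀ (h.norm_left_le w hw) (norm_nonneg _)) (mem_closedBall_zero_iff.1 hz)
  rwa [norm_div, div_le_one (norm_pos_iff.2 (h.eval_right_ne_zero z hz))] at hle

theorem tetraQuotient_mem_tetraTorus (h : IsTetraPair n E D) {z : ℂ} (hz : ‖z‖ = 1) :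
    tetraQuotient n E D z ∈ tetraTorus := by
  have hz' : z ∈ closedUnitDisc := mem_closedBall_zero_iff.2 hz.le
  have hD := h.eval_right_ne_zero z hz'
  have hDc : conj (D.eval z) ≠ 0 := (_root_.map_ne_zero _).2 hD
  simp only [tetraQuotient, eval_conjReflect_of_norm_eq_one h.natDegree_left_le hz,
    eval_conjReflect_of_norm_eq_one h.natDegree_right_le hz]
  refine ⟨?_, ?_, ?_⟩
  · rw [map_div₀]
    field_simp
  · rw [norm_div, norm_mul, norm_pow, hz, one_pow, one_mul, RCLike.norm_conj,
      div_self (norm_ne_zero_iff.2 hD)]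
  · rw [norm_div]
    exact div_le_one_of_le₀ (h.norm_left_le z hz) (norm_nonneg _)

theorem tetraQuotient_mem_tetraBoundary (h : IsTetraPair n E D) {z : ℂ} (hz : ‖z‖ = 1) :
    tetraQuotient n E D z ∈ tetraBoundary :=
  tetraBoundary_eq_tetraTorus.ge (h.tetraQuotient_mem_tetraTorus hz)

theorem tendsto_radial (h : IsTetraPair n E D)
    {x : ℂ → ℂ × ℂ × ℂ} (hx : EqOn x (tetraQuotient n E D) unitDisc)
    {z : ℂ} (hz : ‖z‖ = 1) :
    Tendsto (fun r : ℝ => x (r * z)) (𝓝[<] 1) (𝓝 (tetraQuotient n E D z)) :=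
  tendsto_radial_of_eqOn_unitDisc h.continuousOn_tetraQuotient hx hz

theorem isRationalTetraInner (h : IsTetraPair n E D)
    {x : ℂ → ℂ × ℂ × ℂ} (hx : EqOn x (tetraQuotient n E D) unitDisc) :
    IsRationalTetraInner x := by
  have hrational {f : ℂ → ℂ} (p : ℂ[X]) (hf : ∀ z ∈ unitDisc, f z = p.eval z / D.eval z) :
      IsRationalOnDisc f := ⟨p, D, fun z hz =>
    ⟨h.eval_right_ne_zero z (Metric.ball_subset_closedBall hz), hf z hz⟩⟩
  refine ⟨⟨h.diffContOnCl_tetraQuotient.differentiableOn.congr hx, ?_, ?_⟩,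
    hrational _ fun z hz => congrArg Prod.fst (hx hz),
    hrational _ fun z hz => congrArg (fun y => y.2.1) (hx hz),
    hrational _ fun z hz => congrArg (fun y => y.2.2) (hx hz)⟩
  · exact ((mapsTo_closure_tetrablock_of_circle h.diffContOnCl_tetraQuotient
      fun _ => h.tetraQuotient_mem_tetraTorus).mono_left
        Metric.ball_subset_closedBall).congr hx.symm
  · exact Eventually.of_forall fun θ =>
      ⟨_, h.tetraQuotient_mem_tetraBoundary (norm_exp_ofReal_mul_I θ),
        h.tendsto_radial hx (norm_exp_ofReal_mul_I θ)⟩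

/-- The restriction of `tetraQuotient n E D` to the unit circle, as a map into `tetraBoundary`. -/
noncomputable def boundaryMap (h : IsTetraPair n E D) : C(Circle, tetraBoundary) where
  toFun ζ := ⟨tetraQuotient n E D ζ, h.tetraQuotient_mem_tetraBoundary (Circle.norm_coe ζ)⟩
  continuous_toFun := Continuous.subtype_mk
    (h.continuousOn_tetraQuotient.comp_continuous (by fun_prop)
      fun ζ => mem_closedBall_zero_iff.2 (Circle.norm_coe ζ).le) _

/-- With `D = exp L`, the function `D^{∼n} / D = zⁿ D̄ / D` on the circle has argument
`n arg z - 2 Im L`, and only the first summand contributes to its winding number. -/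
theorem exists_argument_lift (h : IsTetraPair n E D) :
    ∃ Γ : C(unitInterval, ℝ), Γ 1 = Γ 0 + (n : ℤ) * (2 * Real.pi) ∧
      ∀ t : unitInterval, (Circle.exp (Γ t) : ℂ)
        = (tetraQuotient n E D (Circle.exp (2 * Real.pi * (t : ℝ)))).2.2 := by
  obtain ⟨L, hL, hexp⟩ :=
    exists_continuous_exp_eq D.continuous.continuousOn h.eval_right_ne_zero
  let Γ : C(unitInterval, ℝ) := ⟨fun t => n * (2 * Real.pi * (t : ℝ))
    - 2 * (L (Circle.exp (2 * Real.pi * (t : ℝ)))).im, by fun_prop⟩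
  refine ⟨Γ, ?_, fun t => ?_⟩
  · simp only [Γ, ContinuousMap.coe_mk, Icc.coe_one, Icc.coe_zero, mul_one,
      mul_zero, Circle.exp_two_pi, Circle.exp_zero, Int.cast_natCast]
    ring
  · set ζ := Circle.exp (2 * Real.pi * (t : ℝ)) with hζ
    have hnorm : ‖(ζ : ℂ)‖ = 1 := Circle.norm_coe ζ
    have hpow : (ζ : ℂ) ^ n = Complex.exp (n * ((2 * Real.pi * (t : ℝ) : ℝ) * I)) := by
      rw [exp_nat_mul, hζ, Circle.coe_exp]
    have hΓ : (Γ t : ℂ) = n * (2 * Real.pi * (t : ℝ) : ℝ) - 2 * (L ζ).im := by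
      simp only [Γ, ContinuousMap.coe_mk, ← hζ]
      push_cast
      rfl
    have him := sub_conj (L ζ)
    push_cast at him
    rw [tetraQuotient, eval_conjReflect_of_norm_eq_one h.natDegree_right_le hnorm,
      ← hexp _ (mem_closedBall_zero_iff.2 hnorm.le), ← exp_conj, hpow, ← Complex.exp_add,
      ← Complex.exp_sub, Circle.coe_exp, hΓ]
    congr 1
    linear_combination him

theorem hasTetraDegree (h : IsTetraPair n E D)
    {x : ℂ → ℂ × ℂ × ℂ} (hx : EqOn x (tetraQuotient n E D) unitDisc) :
    HasTetraDegree x n := by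
  obtain ⟨Γ, hends, hlift⟩ := h.exists_argument_lift
  exact ⟨h.boundaryMap, fun ζ => h.tendsto_radial hx (Circle.norm_coe ζ),
    exists_tetraBoundary_mulEquiv h.boundaryMap Γ n hlift hends⟩

end IsTetraPair

theorem isTetraRepresentation_iff {n : ℕ} {x : ℂ → ℂ × ℂ × ℂ} {E₁ E₂ D : ℂ[X]} :
    IsTetraRepresentation n x E₁ E₂ D ↔
      IsTetraPair n E₂ D ∧ E₁ = conjReflect n E₂ ∧ EqOn x (tetraQuotient n E₂ D) unitDisc := by
  constructor
  · intro h
    obtain rfl : E₁ = conjReflect n E₂ :=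
      eq_of_eval_eq_on_circle fun z hz => h.E₁_eq z (mem_closedBall_zero_iff.2 hz.le)
    exact ⟨⟨h.natDegree_E₂_le, h.natDegree_D_le, h.D_ne_zero,
        fun z hz => h.norm_E₂_le z (mem_closedBall_zero_iff.2 hz.le)⟩, rfl,
      fun z hz => Prod.ext (h.x₁_eq.eq_on_unitDisc hz)
        (Prod.ext (h.x₂_eq.eq_on_unitDisc hz) (h.x₃_eq.eq_on_unitDisc hz))⟩
  · rintro ⟨h, rfl, hx⟩
    exact
      { natDegree_E₁_le := natDegree_conjReflect_le h.natDegree_left_le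
        natDegree_E₂_le := h.natDegree_left_le
        natDegree_D_le := h.natDegree_right_le
        D_ne_zero := h.eval_right_ne_zero
        x₃_eq := extensionEqOnClosedDisc_of_eq_div h.eval_right_ne_zero
          fun z hz => congrArg (fun y => y.2.2) (hx hz)
        x₁_eq := extensionEqOnClosedDisc_of_eq_div h.eval_right_ne_zero
          fun z hz => congrArg Prod.fst (hx hz)
        x₂_eq := extensionEqOnClosedDisc_of_eq_div h.eval_right_ne_zero
          fun z hz => congrArg (fun y => y.2.1) (hx hz)
        norm_E₁_le := fun _ => h.conjReflect_left.norm_eval_left_le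
        norm_E₂_le := fun _ => h.norm_eval_left_le
        E₁_eq := fun _ _ => rfl }

/-! ### Polynomials from tetra-inner functions -/

theorem IsTetraInner.mem_tetraTorus_of_eqOn {x y : ℂ → ℂ × ℂ × ℂ} (hx : IsTetraInner x)
    (hy : ContinuousOn y closedUnitDisc) (hxy : EqOn x y unitDisc) {z : ℂ} (hz : ‖z‖ = 1) :
    y z ∈ tetraTorus := by
  refine mem_of_ae_mem_of_continuousOn_sphere isClosed_tetraTorus
    (hy.mono Metric.sphere_subset_closedBall) ?_ hz
  filter_upwards [hx.2.2] with θ ⟨l, hl, hlim⟩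
  rw [← tendsto_nhds_unique hlim
    (tendsto_radial_of_eqOn_unitDisc hy hxy (norm_exp_ofReal_mul_I θ))]
  exact tetraBoundary_eq_tetraTorus.le hl

theorem exists_eval_div_eq_conjReflect_div {p q : ℂ[X]} (hpq : IsCoprime p q)
    (h : ∀ z : ℂ, ‖z‖ = 1 → ‖p.eval z‖ = ‖q.eval z‖) :
    ∃ (N : ℕ) (u : ℂ), ‖u‖ = 1 ∧ q.natDegree ≤ N ∧ ∀ z : ℂ,
      p.eval z / q.eval z = (conjReflect N (C u * q)).eval z / (C u * q).eval z := by
  obtain ⟨N, u, hu, hN, heq⟩ := exists_C_mul_eq_conjReflect_of_norm_eq hpq h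
  have hu0 : u ≠ 0 := norm_ne_zero_iff.1 (hu ▸ one_ne_zero)
  refine ⟨N, u, hu, hN, fun z => ?_⟩
  rw [← heq, eval_mul, eval_mul, eval_C, mul_div_mul_left _ _ hu0]

theorem exists_isTetraPair_of_mem_tetraTorus {p₁ q₁ p₂ q₂ D : ℂ[X]} {N : ℕ}
    (hD : D.natDegree ≤ N) (hD0 : ∀ z ∈ closedUnitDisc, D.eval z ≠ 0)
    (hq₁ : ∀ z ∈ closedUnitDisc, q₁.eval z ≠ 0) (hq₂ : ∀ z ∈ closedUnitDisc, q₂.eval z ≠ 0)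
    (h : ∀ z : ℂ, ‖z‖ = 1 → ((p₁.eval z / q₁.eval z, p₂.eval z / q₂.eval z,
      (conjReflect N D).eval z / D.eval z) : ℂ × ℂ × ℂ) ∈ tetraTorus) :
    ∃ E : ℂ[X], IsTetraPair N E D ∧ ∀ z ∈ closedUnitDisc, tetraQuotient N E D z =
      (p₁.eval z / q₁.eval z, p₂.eval z / q₂.eval z, (conjReflect N D).eval z / D.eval z) := by
  obtain ⟨E, hE, hE₁, hE₂⟩ := exists_eq_mul_and_eq_conjReflect_mul (N := N) (p := p₁ * D)
    (r := p₂ * D) hq₁ hq₂ fun z hz => by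
      have hDz := hD0 z (mem_closedBall_zero_iff.2 hz.le)
      have h₁ := (h z hz).1
      simp only [eval_conjReflect_of_norm_eq_one hD hz] at h₁
      rw [eval_mul, eval_mul, mul_div_right_comm, mul_div_right_comm, h₁, map_mul]
      field_simp
  have hquot {z : ℂ} (hz : z ∈ closedUnitDisc) : tetraQuotient N E D z =
      (p₁.eval z / q₁.eval z, p₂.eval z / q₂.eval z, (conjReflect N D).eval z / D.eval z) := by
    have h₁ := congrArg (eval z) hE₁
    have h₂ := congrArg (eval z) hE₂
    rw [eval_mul, eval_mul] at h₁ h₂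
    refine Prod.ext ?_ (Prod.ext ?_ rfl)
    · rw [tetraQuotient, div_eq_div_iff (hD0 z hz) (hq₁ z hz), h₁, mul_comm]
    · rw [tetraQuotient, div_eq_div_iff (hD0 z hz) (hq₂ z hz), h₂, mul_comm]
  refine ⟨E, ⟨hE, hD, hD0, fun z hz => ?_⟩, fun z hz => hquot hz⟩
  have hz' : z ∈ closedUnitDisc := mem_closedBall_zero_iff.2 hz.le
  have hle := (h z hz).2.2
  rw [← hquot hz'] at hle
  rwa [tetraQuotient, norm_div, div_le_one (norm_pos_iff.2 (hD0 z hz'))] at hle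

theorem IsRationalTetraInner.exists_isTetraPair {x : ℂ → ℂ × ℂ × ℂ} (hx : IsRationalTetraInner x) :
    ∃ (N : ℕ) (E D : ℂ[X]), IsTetraPair N E D ∧ EqOn x (tetraQuotient N E D) unitDisc := by
  obtain ⟨hinner, hx₁, hx₂, hx₃⟩ := hx
  obtain ⟨p₁, q₁, -, hq₁, hx₁⟩ := hx₁.exists_isCoprime_of_norm_le fun z hz =>
    norm_fst_le_one_of_mem_closure_tetrablock (hinner.2.1 hz)
  obtain ⟨p₂, q₂, -, hq₂, hx₂⟩ := hx₂.exists_isCoprime_of_norm_le fun z hz =>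
    norm_snd_le_one_of_mem_closure_tetrablock (hinner.2.1 hz)
  obtain ⟨p₃, q₃, hcoprime, hq₃, hx₃⟩ := hx₃.exists_isCoprime_of_norm_le fun z hz =>
    norm_trd_le_one_of_mem_closure_tetrablock (hinner.2.1 hz)
  let y (z : ℂ) : ℂ × ℂ × ℂ :=
    (p₁.eval z / q₁.eval z, p₂.eval z / q₂.eval z, p₃.eval z / q₃.eval z)
  have hy : ContinuousOn y closedUnitDisc :=
    (p₁.continuousOn.div q₁.continuousOn hq₁).prodMk
      ((p₂.continuousOn.div q₂.continuousOn hq₂).prodMk (p₃.continuousOn.div q₃.continuousOn hq₃))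
  have hxy : EqOn x y unitDisc := fun z hz =>
    Prod.ext (hx₁ z hz) (Prod.ext (hx₂ z hz) (hx₃ z hz))
  have htorus {z : ℂ} (hz : ‖z‖ = 1) : y z ∈ tetraTorus := hinner.mem_tetraTorus_of_eqOn hy hxy hz
  obtain ⟨N, u, hu, hN, hquot⟩ := exists_eval_div_eq_conjReflect_div hcoprime fun z hz => by
    have hnorm := (htorus hz).2.1
    rwa [norm_div, div_eq_one_iff_eq
      (norm_ne_zero_iff.2 (hq₃ z (mem_closedBall_zero_iff.2 hz.le)))] at hnorm
  have hu0 : u ≠ 0 := norm_ne_zero_iff.1 (hu ▸ one_ne_zero)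
  simp only [y, hquot] at hxy htorus
  obtain ⟨E, hpair, heq⟩ := exists_isTetraPair_of_mem_tetraTorus
    ((natDegree_C_mul_le u q₃).trans hN)
    (fun z hz => by
      rw [eval_mul, eval_C]
      exact mul_ne_zero hu0 (hq₃ z hz)) hq₁ hq₂ fun z hz => htorus hz
  exact ⟨N, E, C u * q₃, hpair, fun z hz =>
    (hxy hz).trans (heq z (Metric.ball_subset_closedBall hz)).symm⟩

theorem IsRationalTetraInner.exists_isTetraRepresentation {n : ℕ} {x : ℂ → ℂ × ℂ × ℂ}
    (hx : IsRationalTetraInner x) (hn : HasTetraDegree x n) :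
    ∃ E₁ E₂ D : ℂ[X], IsTetraRepresentation n x E₁ E₂ D := by
  obtain ⟨N, E, D, hpair, hxeq⟩ := hx.exists_isTetraPair
  obtain rfl : N = n := hasTetraDegree_unique (hpair.hasTetraDegree hxeq) hn
  exact ⟨conjReflect N E, E, D, isTetraRepresentation_iff.2 ⟨hpair, rfl, hxeq⟩⟩

/-! ### Uniqueness of the representation -/

theorem tetraQuotient_C_mul (n : ℕ) (E D : ℂ[X]) {t : ℝ} (ht : t ≠ 0) :
    tetraQuotient n (C (t : ℂ) * E) (C (t : ℂ) * D) = tetraQuotient n E D := by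
  funext z
  simp only [tetraQuotient, conjReflect_C_mul, conj_ofReal, eval_mul, eval_C,
    mul_div_mul_left _ _ (ofReal_ne_zero.2 ht)]

theorem IsTetraPair.C_mul {n : ℕ} {E D : ℂ[X]} (h : IsTetraPair n E D) {c : ℂ} (hc : c ≠ 0) :
    IsTetraPair n (C c * E) (C c * D) where
  natDegree_left_le := (natDegree_C_mul_le _ _).trans h.natDegree_left_le
  natDegree_right_le := (natDegree_C_mul_le _ _).trans h.natDegree_right_le
  eval_right_ne_zero z hz := by
    rw [eval_mul, eval_C]
    exact mul_ne_zero hc (h.eval_right_ne_zero z hz)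
  norm_left_le z hz := by
    rw [eval_mul, eval_mul, norm_mul, norm_mul]
    exact mul_le_mul_of_nonneg_left (h.norm_left_le z hz) (norm_nonneg _)

theorem IsTetraRepresentation.C_mul {n : ℕ} {x : ℂ → ℂ × ℂ × ℂ} {E₁ E₂ D : ℂ[X]}
    (h : IsTetraRepresentation n x E₁ E₂ D) {t : ℝ} (ht : t ≠ 0) :
    IsTetraRepresentation n x (C (t : ℂ) * E₁) (C (t : ℂ) * E₂) (C (t : ℂ) * D) := by
  obtain ⟨hpair, rfl, hx⟩ := isTetraRepresentation_iff.1 h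
  refine isTetraRepresentation_iff.2 ⟨hpair.C_mul (ofReal_ne_zero.2 ht), ?_, ?_⟩
  · rw [conjReflect_C_mul, conj_ofReal]
  · rwa [tetraQuotient_C_mul n E₂ D ht]

theorem mul_eq_mul_of_eval_div_eq {p q r s : ℂ[X]} (hq : ∀ z ∈ unitDisc, q.eval z ≠ 0)
    (hs : ∀ z ∈ unitDisc, s.eval z ≠ 0)
    (h : ∀ z ∈ unitDisc, p.eval z / q.eval z = r.eval z / s.eval z) : p * s = r * q := by
  have hinf : unitDisc.Infinite := infinite_of_mem_nhds 0 (Metric.ball_mem_nhds 0 one_pos)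
  refine eq_of_infinite_eval_eq _ _ (hinf.mono fun z hz => ?_)
  have hcross := h z hz
  rw [div_eq_div_iff (hq z hz) (hs z hz)] at hcross
  rwa [mem_ofPred_eq, eval_mul, eval_mul]

/-- `D` is recovered from `D^{∼n} / D`, a fraction in lowest terms, up to a constant, which is
real because the same constant multiplies `D^{∼n}`. -/
theorem exists_eq_C_ofReal_mul_of_conjReflect_mul_eq {n : ℕ} {D D' : ℂ[X]}
    (hdeg : D.natDegree ≤ n) (hdeg' : D'.natDegree ≤ n)
    (hD : ∀ z ∈ closedUnitDisc, D.eval z ≠ 0) (hD' : ∀ z ∈ closedUnitDisc, D'.eval z ≠ 0)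
    (h : conjReflect n D * D' = conjReflect n D' * D) :
    ∃ t : ℝ, t ≠ 0 ∧ D' = C (t : ℂ) * D := by
  have hdvd : D ∣ D' :=
    (isCoprime_conjReflect hdeg hD hD).dvd_of_dvd_mul_left (h ▸ dvd_mul_left D _)
  have hdvd' : D' ∣ D :=
    (isCoprime_conjReflect hdeg' hD' hD').dvd_of_dvd_mul_left (h ▸ dvd_mul_left D' _)
  obtain ⟨c, hc, rfl⟩ : ∃ c : ℂ, c ≠ 0 ∧ D' = C c * D := by
    obtain ⟨u, hu⟩ := associated_of_dvd_dvd hdvd hdvd'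
    obtain ⟨c, hc, hcu⟩ := Polynomial.isUnit_iff.1 u.isUnit
    exact ⟨c, hc.ne_zero, by rw [← hu, ← hcu, mul_comm]⟩
  have hD0 : D ≠ 0 := by
    rintro rfl
    exact hD 0 (Metric.mem_closedBall_self zero_le_one) eval_zero
  rw [conjReflect_C_mul, mul_left_comm, mul_assoc] at h
  have hreal : conj c = c :=
    (C_injective (mul_right_cancel₀ (mul_ne_zero (conjReflect_ne_zero n hD0) hD0) h)).symm
  obtain ⟨t, rfl⟩ := conj_eq_iff_real.1 hreal
  exact ⟨t, ofReal_ne_zero.1 hc, rfl⟩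

theorem IsTetraRepresentation.exists_eq_C_mul {n : ℕ} {x : ℂ → ℂ × ℂ × ℂ}
    {E₁ E₂ D E₁' E₂' D' : ℂ[X]} (h : IsTetraRepresentation n x E₁ E₂ D)
    (h' : IsTetraRepresentation n x E₁' E₂' D') :
    ∃ t : ℝ, t ≠ 0 ∧ E₁' = C (t : ℂ) * E₁ ∧ E₂' = C (t : ℂ) * E₂ ∧ D' = C (t : ℂ) * D := by
  have hD (z : ℂ) (hz : z ∈ unitDisc) := h.D_ne_zero z (Metric.ball_subset_closedBall hz)
  have hD' (z : ℂ) (hz : z ∈ unitDisc) := h'.D_ne_zero z (Metric.ball_subset_closedBall hz)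
  have hcross {f : ℂ → ℂ} {p p' : ℂ[X]}
      (hp : ExtensionEqOnClosedDisc f fun z => p.eval z / D.eval z)
      (hp' : ExtensionEqOnClosedDisc f fun z => p'.eval z / D'.eval z) : p * D' = p' * D :=
    mul_eq_mul_of_eval_div_eq hD hD' fun z hz =>
      (hp.eq_on_unitDisc hz).symm.trans (hp'.eq_on_unitDisc hz)
  obtain ⟨t, ht, rfl⟩ := exists_eq_C_ofReal_mul_of_conjReflect_mul_eq h.natDegree_D_le
    h'.natDegree_D_le h.D_ne_zero h'.D_ne_zero (hcross h.x₃_eq h'.x₃_eq)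
  have hD0 : D ≠ 0 := by
    rintro rfl
    exact h.D_ne_zero 0 (Metric.mem_closedBall_self zero_le_one) eval_zero
  have hscale {p p' : ℂ[X]} (hp : p * (C (t : ℂ) * D) = p' * D) : p' = C (t : ℂ) * p :=
    mul_right_cancel₀ hD0 (by rw [← hp]; ring)
  exact ⟨t, ht, hscale (hcross h.x₁_eq h'.x₁_eq), hscale (hcross h.x₂_eq h'.x₂_eq), rfl⟩

/-! ### Cancellation of common zeros on the circle -/

theorem tetraQuotient_mul_right {m n : ℕ} {E D l : ℂ[X]} (hE : E.natDegree ≤ n)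
    (hD : D.natDegree ≤ n) (hl : l.natDegree ≤ m) (hself : conjReflect m l = l) {z : ℂ}
    (hz : l.eval z ≠ 0) : tetraQuotient (n + m) (E * l) (D * l) z = tetraQuotient n E D z := by
  simp only [tetraQuotient, conjReflect_mul hE hl, conjReflect_mul hD hl, hself, eval_mul,
    mul_div_mul_right _ _ hz]

theorem exists_conjReflect_C_mul_X_sub_C_eq_self {a : ℂ} (ha : ‖a‖ = 1) :
    ∃ v : ℂ, v ≠ 0 ∧ conjReflect 1 (C v * (X - C a)) = C v * (X - C a) := by
  obtain ⟨v, hv, hav⟩ := exists_norm_eq_one_mul_eq_conj (c := -a) (by rw [norm_neg, ha])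
  refine ⟨v, norm_ne_zero_iff.1 (hv ▸ one_ne_zero), Eq.symm ?_⟩
  refine (eq_conjReflect_iff ((natDegree_C_mul_le _ _).trans_eq (natDegree_X_sub_C a))).2
    fun z hz => ?_
  simp only [eval_mul, eval_C, eval_sub, eval_X, map_mul, map_sub, ← hav]
  linear_combination a * v * mul_conj_eq_one_of_norm_eq_one hz
    - v * z * mul_conj_eq_one_of_norm_eq_one ha

theorem exists_eq_mul_C_mul_X_sub_C {n : ℕ} {p : ℂ[X]} {a v : ℂ} (hv : v ≠ 0)
    (hdeg : p.natDegree ≤ n + 1) (ha : p.eval a = 0) :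
    ∃ q : ℂ[X], q.natDegree ≤ n ∧ p = q * (C v * (X - C a)) := by
  obtain ⟨q, rfl⟩ := dvd_iff_isRoot.2 ha
  refine ⟨C v⁻¹ * q, (natDegree_C_mul_le _ _).trans ?_, ?_⟩
  · rcases eq_or_ne q 0 with rfl | hq
    · exact natDegree_zero.trans_le n.zero_le
    · rw [natDegree_mul (X_sub_C_ne_zero a) hq, natDegree_X_sub_C] at hdeg
      omega
  · have hC : C v⁻¹ * C v = 1 := by rw [← C_mul, inv_mul_cancel₀ hv, C_1]
    linear_combination -((X - C a) * q) * hC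

/-- A zero of `D` on the circle is a zero of `E`; the linear factor cancelled from both is scaled
so as to be its own reflection, and then it cancels from `E^{∼n}` and `D^{∼n}` as well. -/
theorem exists_tetraQuotient_eqOn_of_eval_eq_zero {n : ℕ} {E D : ℂ[X]} {a : ℂ} (ha : ‖a‖ = 1)
    (hE : E.natDegree ≤ n + 1) (hD : D.natDegree ≤ n + 1)
    (hle : ∀ z ∈ unitDisc, ‖E.eval z‖ ≤ ‖D.eval z‖) (hne : ∀ z ∈ unitDisc, D.eval z ≠ 0)
    (hDa : D.eval a = 0) :
    ∃ E' D' : ℂ[X], E'.natDegree ≤ n ∧ D'.natDegree ≤ n ∧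
      (∀ z ∈ unitDisc, ‖E'.eval z‖ ≤ ‖D'.eval z‖) ∧ (∀ z ∈ unitDisc, D'.eval z ≠ 0) ∧
      EqOn (tetraQuotient (n + 1) E D) (tetraQuotient n E' D') unitDisc := by
  have hEa : E.eval a = 0 := by
    have hlea := norm_eval_le_on_closedUnitDisc hle (mem_closedBall_zero_iff.2 ha.le)
    rwa [hDa, norm_zero, norm_le_zero_iff] at hlea
  obtain ⟨v, hv, hself⟩ := exists_conjReflect_C_mul_X_sub_C_eq_self ha
  obtain ⟨E', hE', rfl⟩ := exists_eq_mul_C_mul_X_sub_C hv hE hEa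
  obtain ⟨D', hD', rfl⟩ := exists_eq_mul_C_mul_X_sub_C hv hD hDa
  have hl (z : ℂ) (hz : z ∈ unitDisc) : (C v * (X - C a)).eval z ≠ 0 := fun h0 =>
    hne z hz (by rw [eval_mul, h0, mul_zero])
  refine ⟨E', D', hE', hD', fun z hz => ?_, fun z hz h0 => ?_, fun z hz => ?_⟩
  · have hlez := hle z hz
    rw [eval_mul, norm_mul, eval_mul (p := D'), norm_mul] at hlez
    exact le_of_mul_le_mul_right hlez (norm_pos_iff.2 (hl z hz))
  · exact hne z hz (by rw [eval_mul, h0, zero_mul])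
  · exact tetraQuotient_mul_right hE' hD'
      ((natDegree_C_mul_le _ _).trans_eq (natDegree_X_sub_C a)) hself (hl z hz)

theorem exists_isTetraPair_of_ne_zero_on_unitDisc {n : ℕ} {E D : ℂ[X]} (hE : E.natDegree ≤ n)
    (hD : D.natDegree ≤ n) (hle : ∀ z ∈ unitDisc, ‖E.eval z‖ ≤ ‖D.eval z‖)
    (hne : ∀ z ∈ unitDisc, D.eval z ≠ 0) :
    ∃ m ≤ n, ∃ F G : ℂ[X], IsTetraPair m F G ∧
      EqOn (tetraQuotient n E D) (tetraQuotient m F G) unitDisc := by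
  have hpair {k : ℕ} {E D : ℂ[X]} (hE : E.natDegree ≤ k) (hD : D.natDegree ≤ k)
      (hle : ∀ z ∈ unitDisc, ‖E.eval z‖ ≤ ‖D.eval z‖)
      (hroot : ∀ z ∈ closedUnitDisc, D.eval z ≠ 0) : IsTetraPair k E D :=
    ⟨hE, hD, hroot, fun z hz =>
      norm_eval_le_on_closedUnitDisc hle (mem_closedBall_zero_iff.2 hz.le)⟩
  induction n generalizing E D with
  | zero =>
    refine ⟨0, le_rfl, E, D, hpair hE hD hle fun z _ h0 => ?_, fun _ _ => rfl⟩
    rw [eq_C_of_natDegree_le_zero hD, eval_C, coeff_zero_eq_eval_zero] at h0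
    exact hne 0 (Metric.mem_ball_self one_pos) h0
  | succ k ih =>
    by_cases hroot : ∀ z ∈ closedUnitDisc, D.eval z ≠ 0
    · exact ⟨k + 1, le_rfl, E, D, hpair hE hD hle hroot, fun _ _ => rfl⟩
    push Not at hroot
    obtain ⟨a, ha, hDa⟩ := hroot
    have ha1 : ‖a‖ = 1 := (mem_closedBall_zero_iff.1 ha).antisymm <| le_of_not_gt fun hlt =>
      hne a (mem_ball_zero_iff.2 hlt) hDa
    obtain ⟨E', D', hE', hD', hle', hne', heq⟩ :=
      exists_tetraQuotient_eqOn_of_eval_eq_zero ha1 hE hD hle hne hDa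
    obtain ⟨m, hm, F, G, hFG, heq'⟩ := ih hE' hD' hle' hne'
    exact ⟨m, hm.trans k.le_succ, F, G, hFG, heq.trans heq'⟩

theorem mainTheorem1 (n : ℕ) :
    -- existence, and uniqueness up to a nonzero real factor
    (∀ x : ℂ → ℂ × ℂ × ℂ, IsRationalTetraInner x → HasTetraDegree x n →
      (∃ E₁ E₂ D : ℂ[X], IsTetraRepresentation n x E₁ E₂ D) ∧
      (∀ E₁ E₂ D : ℂ[X], IsTetraRepresentation n x E₁ E₂ D →
        ∀ E₁' E₂' D' : ℂ[X], IsTetraRepresentation n x E₁' E₂' D' ↔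
          ∃ t : ℝ, t ≠ 0 ∧ E₁' = C (t : ℂ) * E₁ ∧ E₂' = C (t : ℂ) * E₂ ∧
            D' = C (t : ℂ) * D)) ∧
    -- the converse
    (∀ E₁ E₂ D : ℂ[X],
      E₁.natDegree ≤ n → E₂.natDegree ≤ n → D.natDegree ≤ n →
      (∀ z ∈ closedUnitDisc, ‖E₁.eval z‖ ≤ ‖D.eval z‖) →
      (∀ z ∈ closedUnitDisc, ‖E₂.eval z‖ ≤ ‖D.eval z‖) →
      (∀ z ∈ closedUnitDisc, E₁.eval z = (conjReflect n E₂).eval z) →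
      (∀ z ∈ unitDisc, D.eval z ≠ 0) →
      ∀ x : ℂ → ℂ × ℂ × ℂ,
        (∀ z ∈ unitDisc, x z = (E₁.eval z / D.eval z, E₂.eval z / D.eval z,
          (conjReflect n D).eval z / D.eval z)) →
        IsRationalTetraInner x ∧ ∃ m ≤ n, HasTetraDegree x m) := by
  refine ⟨fun x hx hn => ⟨hx.exists_isTetraRepresentation hn, fun E₁ E₂ D h E₁' E₂' D' =>
    ⟨h.exists_eq_C_mul, ?_⟩⟩, ?_⟩
  · rintro ⟨t, ht, rfl, rfl, rfl⟩
    exact h.C_mul ht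
  · intro E₁ E₂ D _ hE₂ hD _ hle hE hne x hx
    obtain rfl : E₁ = conjReflect n E₂ :=
      eq_of_eval_eq_on_circle fun z hz => hE z (mem_closedBall_zero_iff.2 hz.le)
    obtain ⟨m, hm, F, G, hFG, heq⟩ := exists_isTetraPair_of_ne_zero_on_unitDisc hE₂ hD
      (fun z hz => hle z (Metric.ball_subset_closedBall hz)) hne
    have hx' : EqOn x (tetraQuotient m F G) unitDisc := fun z hz => (hx z hz).trans (heq hz)
    exact ⟨hFG.isRationalTetraInner hx', m, hm, hFG.hasTetraDegree hx'⟩
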